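/- For a discrete group $G$ let $Z^2(G,\mathbb T)$ be the group of scalar 2-cocycles, i.e. maps $\mu:G\times G\to\mathbb T$ with $\mu_{g,h}\,\mu_{gh,k}=\mu_{h,k}\,\mu_{g,hk}$ for all $g,h,k\in G$, and let $\mathrm H^2(G,\mathbb T)$ be its quotient by the subgroup of coboundaries $(g,h)\mapsto\lambda_g\lambda_h\overline{\lambda_{gh}}$, $\lambda:G\to\mathbb T$. For $\mu\in Z^2(G,\mathbb T)$ let $\lambda_\mu(g)$ be the unitary operator on $\ell^2(G)$ with $\lambda_\mu(g)\xi_h=\mu_{g,h}\,\xi_{gh}$, where $\{\xi_h\}_{h\in G}$ is the canonical basis, and let $L_\mu(G)=\lambda_\mu(G)''$; up to isomorphism it depends only on the class of $\mu$. An inclusion $H\subset G$ of discrete groups has the relative property (T) if there are $\delta_0>0$ and a finite set $F_0\subset G$ such that every unitary representation $\pi$ of $G$ that has a unit vector $\xi$ with $\|\pi(g)\xi-\xi\|<\delta_0$ for all $g\in F_0$ has a non-zero vector $\xi_0$ with $\pi(h)\xi_0=\xi_0$ for all $h\in H$. Theorem 0.2 (= Corollary 1.3). Let $H\subset G$ be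 an inclusion of discrete groups with the relative property (T), and let $M$ be a finite von Neumann algebra (every non-zero positive element of $M$ is non-zero under some finite normal trace on $M$) that is separable (it has separable predual). Let $J$ be the set of classes $[\mu]\in\mathrm H^2(G,\mathbb T)$ such that $L_\mu(G)$ can be embedded, not necessarily unitally, into $M$, i.e. such that there is an injective normal $*$-homomorphism $L_\mu(G)\to M$. Then the set $\{[\mu|_H] : [\mu]\in J\}\subset\mathrm H^2(H,\mathbb T)$ is countable. -/

import Mathlib

universe u

/-! ### Scalar 2-cocycles and second cohomology with values in the circle -/

/-- `Z²(G, 𝕋)`: the scalar 2-cocycles `μ (g, h) * μ (gh, k) = μ (h, k) * μ (g, hk)` (no normalization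
is imposed), as a group under pointwise multiplication. -/
def Z2 (G : Type*) [Group G] : Subgroup (G → G → Circle) where
  carrier := {μ | ∀ g h k : G, μ g h * μ (g * h) k = μ h k * μ g (h * k)}
  one_mem' := fun _ _ _ => rfl
  mul_mem' := by
    intro μ ν hμ hν g h k
    calc (μ g h * ν g h) * (μ (g * h) k * ν (g * h) k)
        = (μ g h * μ (g * h) k) * (ν g h * ν (g * h) k) := mul_mul_mul_comm _ _ _ _
      _ = (μ h k * μ g (h * k)) * (ν h k * ν g (h * k)) := by rw [hμ g h k, hν g h k]
      _ = (μ h k * ν h k) * (μ g (h * k) * ν g (h * k)) := mul_mul_mul_comm _ _ _ _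
  inv_mem' := by
    intro μ hμ g h k
    change (μ g h)⁻¹ * (μ (g * h) k)⁻¹ = (μ h k)⁻¹ * (μ g (h * k))⁻¹
    rw [← mul_inv, ← mul_inv, hμ g h k]

/-- The coboundary `(g, h) ↦ l g * l h * conj (l (gh))` of a function `l : G → 𝕋`, as a group
homomorphism into the 2-cocycles. -/
noncomputable def coboundaryHom (G : Type*) [Group G] : (G → Circle) →* Z2 G where
  toFun l := ⟨fun g h => l g * l h * (l (g * h))⁻¹, by
    intro g h k
    change l g * l h * (l (g * h))⁻¹ * (l (g * h) * l k * (l (g * h * k))⁻¹) =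
      l h * l k * (l (h * k))⁻¹ * (l g * l (h * k) * (l (g * (h * k)))⁻¹)
    rw [mul_assoc g h k]
    ext
    push_cast
    have h1 := Circle.coe_ne_zero (l (g * h))
    have h2 := Circle.coe_ne_zero (l (h * k))
    field_simp⟩
  map_one' := by
    apply Subtype.ext
    funext g h
    simp
  map_mul' l m := by
    apply Subtype.ext
    funext g h
    change l g * m g * (l h * m h) * (l (g * h) * m (g * h))⁻¹ =
      l g * l h * (l (g * h))⁻¹ * (m g * m h * (m (g * h))⁻¹)
    ext
    push_cast
    have h1 := Circle.coe_ne_zero (l (g * h))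
    have h2 := Circle.coe_ne_zero (m (g * h))
    field_simp

/-- `H²(G, 𝕋)`: scalar 2-cocycles modulo coboundaries. -/
abbrev H2 (G : Type*) [Group G] : Type _ := Z2 G ⧸ (coboundaryHom G).range

/-- Restriction of 2-cocycles to a subgroup. -/
noncomputable def Z2.res {G : Type*} [Group G] (H : Subgroup G) : Z2 G →* Z2 H where
  toFun μ := ⟨fun h k => μ.1 h k, fun g h k => μ.2 g h k⟩
  map_one' := rfl
  map_mul' _ _ := rfl

/-- The restriction map `H²(G, 𝕋) → H²(H, 𝕋)`, `[μ] ↦ [μ|_H]`. -/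
noncomputable def H2.res {G : Type*} [Group G] (H : Subgroup G) : H2 G →* H2 H :=
  QuotientGroup.map _ _ (Z2.res H) (by
    rintro _ ⟨l, rfl⟩
    exact ⟨fun h => l h, rfl⟩)

/-! ### Relative property (T) -/

/-- The inclusion `H ⊂ G` of discrete groups has relative property (T): there are `δ₀ > 0` and a
finite `F₀ ⊂ G` such that every unitary representation of `G` with a unit vector moved by less than
`δ₀` by all elements of `F₀` has a nonzero `H`-invariant vector. (Hilbert spaces in the universe of
`G` suffice, since one may pass to the cyclic subrepresentation generated by the unit vector.) -/
def RelativePropertyT {G : Type u} [Group G] (H : Subgroup G) : Prop :=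
  ∃ (δ₀ : ℝ) (F₀ : Finset G), 0 < δ₀ ∧
    ∀ (E : Type u) [NormedAddCommGroup E] [InnerProductSpace ℂ E] [CompleteSpace E]
      (π : G →* unitary (E →L[ℂ] E)) (ξ : E), ‖ξ‖ = 1 →
      (∀ g ∈ F₀, ‖(π g : E →L[ℂ] E) ξ - ξ‖ < δ₀) →
      ∃ ξ₀ : E, ξ₀ ≠ 0 ∧ ∀ h ∈ H, (π h : E →L[ℂ] E) ξ₀ = ξ₀

/-! ### Von Neumann algebras -/

section VN

variable {K : Type*} [NormedAddCommGroup K] [InnerProductSpace ℂ K] [CompleteSpace K]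

/-- The von Neumann algebra `(S ∪ S*)''` generated by a set `S` of bounded operators. -/
noncomputable def generatedVN (S : Set (K →L[ℂ] K)) : VonNeumannAlgebra K where
  toStarSubalgebra :=
    StarSubalgebra.centralizer ℂ (StarSubalgebra.centralizer ℂ S : Set (K →L[ℂ] K))
  centralizer_centralizer' := by
    have hs : star (StarSubalgebra.centralizer ℂ S : Set (K →L[ℂ] K)) =
        (StarSubalgebra.centralizer ℂ S : Set (K →L[ℂ] K)) := by
      ext x
      simp only [Set.mem_star, SetLike.mem_coe]
      exact star_mem_iff
    change Set.centralizer (Set.centralizer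
      ((StarSubalgebra.centralizer ℂ (StarSubalgebra.centralizer ℂ S : Set (K →L[ℂ] K)) :
        StarSubalgebra ℂ (K →L[ℂ] K)) : Set (K →L[ℂ] K))) =
      ((StarSubalgebra.centralizer ℂ (StarSubalgebra.centralizer ℂ S : Set (K →L[ℂ] K)) :
        StarSubalgebra ℂ (K →L[ℂ] K)) : Set (K →L[ℂ] K))
    rw [StarSubalgebra.coe_centralizer ℂ
      (StarSubalgebra.centralizer ℂ S : Set (K →L[ℂ] K)), hs, Set.union_self]
    exact Set.centralizer_centralizer_centralizer _

/-- A linear functional on a von Neumann algebra `M ⊂ B(K)` is normal (ultraweakly continuous) if it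
has the form `x ↦ ∑ ⟪ξₙ, x ηₙ⟫` with `∑ ‖ξₙ‖² < ∞` and `∑ ‖ηₙ‖² < ∞`. -/
def IsNormalFunctional (M : VonNeumannAlgebra K) (f : M.toStarSubalgebra →ₗ[ℂ] ℂ) : Prop :=
  ∃ ξ η : ℕ → K, Summable (fun n => ‖ξ n‖ ^ 2) ∧ Summable (fun n => ‖η n‖ ^ 2) ∧
    ∀ x : M.toStarSubalgebra,
      HasSum (fun n => inner ℂ (ξ n) ((x : K →L[ℂ] K) (η n))) (f x)

/-- `M` is separable: its predual, the space of normal functionals with the norm of the dual of `M`,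
has a countable dense subset. -/
def IsSeparableVN (M : VonNeumannAlgebra K) : Prop :=
  ∃ D : Set (M.toStarSubalgebra →ₗ[ℂ] ℂ), D.Countable ∧ (∀ d ∈ D, IsNormalFunctional M d) ∧
    ∀ f, IsNormalFunctional M f → ∀ ε : ℝ, 0 < ε →
      ∃ d ∈ D, ∀ x : M.toStarSubalgebra, ‖f x - d x‖ ≤ ε * ‖(x : K →L[ℂ] K)‖

open scoped ComplexOrder in
/-- `M` is finite (Dixmier's definition): every nonzero positive element `x* x` of `M` is detected
by some finite normal trace on `M`. -/
def IsFiniteVN (M : VonNeumannAlgebra K) : Prop :=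
  ∀ x : M.toStarSubalgebra, x ≠ 0 →
    ∃ τ : M.toStarSubalgebra →ₗ[ℂ] ℂ, IsNormalFunctional M τ ∧
      (∀ y, 0 ≤ τ (star y * y)) ∧ (∀ y z, τ (y * z) = τ (z * y)) ∧ τ (star x * x) ≠ 0

/-- `N` embeds, not necessarily unitally, into `M` as a von Neumann algebra: there is an injective
normal `*`-homomorphism `N → M`, normality (ultraweak continuity) meaning that normal functionals
pull back to normal functionals. -/
def EmbedsVN {K' : Type*} [NormedAddCommGroup K'] [InnerProductSpace ℂ K'] [CompleteSpace K']
    (N : VonNeumannAlgebra K') (M : VonNeumannAlgebra K) : Prop :=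
  ∃ θ : N.toStarSubalgebra →⋆ₙₐ[ℂ] M.toStarSubalgebra, Function.Injective θ ∧
    ∀ f : M.toStarSubalgebra →ₗ[ℂ] ℂ, IsNormalFunctional M f →
      ∃ f' : N.toStarSubalgebra →ₗ[ℂ] ℂ, IsNormalFunctional N f' ∧ ∀ x, f' x = f (θ x)

end VN

/-! ### The twisted group von Neumann algebra -/

section Twisted

variable {G : Type*} [Group G]

/-- `ℓ²(G)`. -/
abbrev L2G (G : Type*) : Type _ := lp (fun _ : G => ℂ) 2

theorem twistedTranslation_hasSum (μ : G → G → Circle) (g : G) (f : L2G G) :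
    HasSum (fun k => ‖(μ g (g⁻¹ * k) : ℂ) * f (g⁻¹ * k)‖ ^ (2 : ENNReal).toReal)
      (‖f‖ ^ (2 : ENNReal).toReal) := by
  have h := lp.hasSum_norm (p := 2) (by norm_num) f
  rw [← (Equiv.mulLeft g⁻¹).hasSum_iff] at h
  simpa [Function.comp_def, norm_mul, Circle.norm_coe] using h

/-- The operator `λ_μ(g)` of the projective left regular representation,
`(λ_μ(g) f)(k) = μ (g, g⁻¹k) f (g⁻¹k)`, so that `λ_μ(g)` sends the basis vector at `h` to
`μ (g, h)` times the basis vector at `gh`. -/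
noncomputable def twistedTranslation (μ : G → G → Circle) (g : G) : L2G G →L[ℂ] L2G G :=
  LinearIsometry.toContinuousLinearMap
    { toFun := fun f => ⟨fun k => (μ g (g⁻¹ * k) : ℂ) * f (g⁻¹ * k),
        memℓp_gen (twistedTranslation_hasSum μ g f).summable⟩
      map_add' := fun a b => by
        ext k
        exact mul_add _ _ _
      map_smul' := fun c a => by
        ext k
        exact mul_left_comm _ _ _
      norm_map' := fun f => by
        have h1 := twistedTranslation_hasSum μ g f
        have h2 := lp.hasSum_norm (p := 2) (by norm_num)
          (⟨fun k => (μ g (g⁻¹ * k) : ℂ) * f (g⁻¹ * k),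
            memℓp_gen (twistedTranslation_hasSum μ g f).summable⟩ : L2G G)
        have h3 := h2.unique h1
        exact (Real.rpow_left_inj (norm_nonneg _) (norm_nonneg _) (by norm_num)).1 h3 }

open Classical in
theorem twistedTranslation_single (μ : G → G → Circle) (g h : G) :
    twistedTranslation μ g (lp.single 2 h (1 : ℂ)) =
      (μ g h : ℂ) • lp.single 2 (g * h) (1 : ℂ) := by
  ext k
  change (μ g (g⁻¹ * k) : ℂ) * (lp.single 2 h (1 : ℂ) : L2G G) (g⁻¹ * k) =
    (μ g h : ℂ) * (lp.single 2 (g * h) (1 : ℂ) : L2G G) k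
  by_cases hk : k = g * h
  · subst hk
    simp
  · have h2 : g⁻¹ * k ≠ h := fun h' => hk (by rw [← h', mul_inv_cancel_left])
    simp [hk, h2]

/-- The twisted group von Neumann algebra `L_μ(G) = λ_μ(G)''`. -/
noncomputable def twistedGroupVN (μ : Z2 G) : VonNeumannAlgebra (L2G G) :=
  generatedVN (Set.range (twistedTranslation μ.1))

end Twisted

/-!
Suppose that `L_μ(G)` and `L_ν(G)` embed into `M`. The images `u g`, `v g` of their canonical
unitaries are projective representations of `G` in corners `pMp` and `qMq` of `M`. For a finite
normal trace `τ` with `τ p = 1`, the kernel `τ ((y g)* (y h))` with `y g = u g * (v g)*` belongs to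
the projective representation `x ↦ u g * x * (v g)*` of `G` on `L²(M, τ)`, whose cocycle is `μ / ν`.
Its squared absolute value is thus an honest positive definite function on `G`. If the normal
functionals `τ (· u g)` and `τ' (· v g)` (for a trace `τ'` with `τ' q = 1`) are close for `g` in a
suitable finite set, then that function is close to `1` there, hence uniformly on `H` by
`RelativePropertyT.uniform`. The lines spanned by the vectors `y h`, `h ∈ H`, are then uniformly
close to each other, and `exists_common_eigenvector` provides an eigenvector of the projective
representation restricted to `H`, so that `μ / ν` is a coboundary on `H`
(`exists_coboundary_of_twisted_kernel`, `res_eq_of_close`). As the predual of `M` is separable, the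
tuples of functionals `τ (· u g)` fall into countably many classes of close ones, so only
countably many restrictions occur.

Relative property (T) is given in its weak form, that almost invariant vectors entail some
nonzero `H`-invariant vector, with `H` not assumed normal. `RelativePropertyT.uniform` extracts the
uniform form, for countable `G`, from the infinite product of a rapidly convergent sequence of
counterexamples. That `G` is countable, if any `L_μ(G)` embeds, is another consequence of
separability (`countable_of_embedsVN`). All Hilbert spaces are built from positive semidefinite
kernels by `exists_hilbert_of_posSemidef`, which in particular puts the representations of `G` into
the universe of `G`, as the definition of relative property (T) demands.
-/

/-! ### Positive semidefinite kernels and their Hilbert spaces -/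

section Kernels

open scoped ComplexOrder

open Filter Topology in
theorem Matrix.PosSemidef.of_tendsto {X : Type*} {k : ℕ → Matrix X X ℂ} {l : Matrix X X ℂ}
    (hk : ∀ n, (k n).PosSemidef) (hl : ∀ a b, Tendsto (fun n => k n a b) atTop (𝓝 (l a b))) :
    l.PosSemidef := by
  refine ⟨?_, fun c => ?_⟩
  · ext a b
    refine tendsto_nhds_unique (f := fun n => k n a b) ?_ (hl a b)
    have h : (fun n => k n a b) = fun n => star (k n b a) :=
      funext fun n => ((hk n).isHermitian.apply a b).symm
    rw [h]
    exact (continuous_star.tendsto _).comp (hl b a)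
  · refine ge_of_tendsto' (x := atTop) ?_ fun n => (hk n).2 c
    refine tendsto_finsetSum _ fun a _ => tendsto_finsetSum _ fun b _ => ?_
    exact ((hl a b).const_mul _).mul_const _

theorem inner_linearCombination {X E : Type*} [NormedAddCommGroup E] [InnerProductSpace ℂ E]
    (x : X → E) (c d : X →₀ ℂ) :
    inner ℂ (Finsupp.linearCombination ℂ x c) (Finsupp.linearCombination ℂ x d) =
      c.sum fun a r => d.sum fun b s => star r * s * inner ℂ (x a) (x b) := by
  rw [Finsupp.linearCombination_apply, Finsupp.sum_inner]
  refine Finset.sum_congr rfl fun a _ => ?_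
  beta_reduce
  rw [inner_smul_left, Finsupp.linearCombination_apply, Finsupp.inner_sum,
    Finsupp.mul_sum]
  refine Finset.sum_congr rfl fun b _ => ?_
  beta_reduce
  rw [inner_smul_right]
  exact (mul_assoc _ _ _).symm

theorem Matrix.posSemidef_of_inner {X E : Type*} [NormedAddCommGroup E] [InnerProductSpace ℂ E]
    (x : X → E) : (Matrix.of fun a b => inner ℂ (x a) (x b)).PosSemidef := by
  refine ⟨Matrix.ext fun a b => inner_conj_symm (𝕜 := ℂ) (x a) (x b), fun c => ?_⟩
  have h := inner_linearCombination x c c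
  have e : (c.sum fun a r => c.sum fun b s =>
      star r * (Matrix.of fun a b => inner ℂ (x a) (x b)) a b * s) =
      inner ℂ (Finsupp.linearCombination ℂ x c) (Finsupp.linearCombination ℂ x c) := by
    rw [h]
    refine Finset.sum_congr rfl fun a _ => Finset.sum_congr rfl fun b _ => ?_
    simp only [Matrix.of_apply]
    ring
  rw [e]
  rw [inner_self_eq_norm_sq_to_K]
  have h0 : (0 : ℂ) ≤ ((‖Finsupp.linearCombination ℂ x c‖ ^ 2 : ℝ) : ℂ) :=
    Complex.zero_le_real.2 (sq_nonneg _)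
  rwa [Complex.ofReal_pow] at h0

/-- Moore–Aronszajn for scalar kernels: a positive semidefinite kernel on `X` is the Gram matrix of
a total family of vectors in a Hilbert space, which lives in the universe of `X`. -/
theorem exists_hilbert_of_posSemidef {X : Type u} {k : Matrix X X ℂ} (hk : k.PosSemidef) :
    ∃ (E : Type u) (_ : NormedAddCommGroup E) (_ : InnerProductSpace ℂ E) (_ : CompleteSpace E)
      (x : X → E), (∀ a b, inner ℂ (x a) (x b) = k a b) ∧
        DenseRange (Finsupp.linearCombination ℂ x) := by
  let K : Matrix X X (ℂ →L[ℂ] ℂ) := Matrix.of fun a b => k a b • ContinuousLinearMap.id ℂ ℂ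
  have hK : K.PosSemidef := by
    have hT := (RKHS.posSemidef_tfae (K := K)).out 0 2
    refine hT.2 ⟨?_, fun v => ?_⟩
    · ext a b
      have h := hk.isHermitian.apply a b
      simp only [K, Matrix.conjTranspose_apply, Matrix.of_apply, star_smul]
      simp only [ContinuousLinearMap.star_eq_adjoint, ContinuousLinearMap.adjoint_id]
      simpa using h
    · have h := (Complex.le_def.1 (hk.2 v)).1
      have e : (v.sum fun x w => v.sum fun x' w' => inner ℂ (K x' x w) w') =
          star (v.sum fun x w => v.sum fun x' w' => star w' * k x' x * w) := by
        simp only [star_finsuppSum]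
        refine Finset.sum_congr rfl fun x _ => ?_
        refine Eq.trans ?_ (star_finsuppSum _ _).symm
        refine Finset.sum_congr rfl fun y _ => ?_
        change inner ℂ (k y x * v x) (v y) = _
        simp
        ring
      rw [e, RCLike.star_def, RCLike.conj_re, Finsupp.sum_comm]
      exact h
  have : Fact K.PosSemidef := ⟨hK⟩
  let x : X → RKHS.OfKernel K := fun a => RKHS.kerFun (RKHS.OfKernel K) a 1
  refine ⟨RKHS.OfKernel K, inferInstance, inferInstance, inferInstance, x, fun a b => ?_, ?_⟩
  · rw [← RKHS.kernel_inner, RKHS.OfKernel.kernel_ofKernel]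
    rw [← hk.isHermitian.apply a b]
    change inner ℂ (k b a * 1) 1 = _
    simp
  · have h := RKHS.kerFun_dense (RKHS.OfKernel K)
    rw [← Submodule.dense_iff_topologicalClosure_eq_top] at h
    rw [DenseRange, ← LinearMap.coe_range, Finsupp.range_linearCombination]
    suffices hs : Submodule.span ℂ (Set.range x) =
        Submodule.span ℂ {f | ∃ a v, RKHS.kerFun (RKHS.OfKernel K) a v = f} by
      rw [hs]
      exact h
    refine le_antisymm (Submodule.span_le.2 ?_) (Submodule.span_le.2 ?_)
    · rintro _ ⟨a, rfl⟩
      exact Submodule.subset_span ⟨a, 1, rfl⟩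
    · rintro _ ⟨a, z, rfl⟩
      have e : RKHS.kerFun (RKHS.OfKernel K) a z = z • x a := by
        rw [← map_smul, smul_eq_mul, mul_one]
      rw [e]
      exact Submodule.smul_mem _ _ (Submodule.subset_span ⟨a, rfl⟩)

/-- Two families with the same Gram matrix, the first of them total, are related by an isometry. -/
theorem exists_isometry_of_gram_eq {X E : Type*} [NormedAddCommGroup E] [InnerProductSpace ℂ E]
    [CompleteSpace E] {x y : X → E} (hx : DenseRange (Finsupp.linearCombination ℂ x))
    (h : ∀ a b, inner ℂ (y a) (y b) = inner ℂ (x a) (x b)) :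
    ∃ U : E →ₗᵢ[ℂ] E, ∀ a, U (x a) = y a := by
  have hn : ∀ c, ‖Finsupp.linearCombination ℂ y c‖ = ‖Finsupp.linearCombination ℂ x c‖ := by
    intro c
    rw [@norm_eq_sqrt_re_inner ℂ, @norm_eq_sqrt_re_inner ℂ, inner_linearCombination,
      inner_linearCombination]
    simp only [h]
  have hb : ∃ C, ∀ c, ‖Finsupp.linearCombination ℂ y c‖ ≤
      C * ‖Finsupp.linearCombination ℂ x c‖ := ⟨1, fun c => by rw [hn, one_mul]⟩
  let U := (Finsupp.linearCombination ℂ y).extendOfNorm (Finsupp.linearCombination ℂ x)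
  have hU : ∀ c, U (Finsupp.linearCombination ℂ x c) = Finsupp.linearCombination ℂ y c :=
    LinearMap.extendOfNorm_eq hx hb
  refine ⟨⟨U, fun v => ?_⟩, fun a => ?_⟩
  · refine hx.induction_on (p := fun v => ‖U v‖ = ‖v‖) v
      (isClosed_eq (by fun_prop) (by fun_prop)) fun c => ?_
    rw [hU, hn]
  · simpa using hU (Finsupp.single a 1)

theorem ContinuousLinearMap.eq_of_total {X E : Type*} [NormedAddCommGroup E] [InnerProductSpace ℂ E]
    {x : X → E} (hx : DenseRange (Finsupp.linearCombination ℂ x)) {U V : E →L[ℂ] E}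
    (h : ∀ a, U (x a) = V (x a)) : U = V := by
  refine DFunLike.coe_injective (hx.equalizer U.continuous V.continuous (funext fun c => ?_))
  simp [Finsupp.linearCombination_apply, Finsupp.sum, h]

/-- The Hilbert space tensor product of `V` with its conjugate, that is, the Hilbert–Schmidt
operators on `V` with `e a b` standing for the rank one operator `v ↦ ⟪b, v⟫ • a`. -/
theorem exists_hilbertSchmidt (V : Type u) [NormedAddCommGroup V] [InnerProductSpace ℂ V] :
    ∃ (E : Type u) (_ : NormedAddCommGroup E) (_ : InnerProductSpace ℂ E) (e : V → V → E),
      ∀ a b c d, inner ℂ (e a b) (e c d) = inner ℂ a c * inner ℂ d b := by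
  have h1 := Matrix.posSemidef_of_inner (fun v : V × V => v.1) (E := V)
  have h2 := (Matrix.posSemidef_of_inner (fun v : V × V => v.2) (E := V)).transpose
  obtain ⟨E, i1, i2, -, x, hx, -⟩ := exists_hilbert_of_posSemidef (h1.hadamard h2)
  refine ⟨E, i1, i2, fun a b => x (a, b), fun a b c d => ?_⟩
  rw [hx]
  simp [Matrix.hadamard]

end Kernels

/-! ### Positive definite functions and uniform relative property (T) -/

section PositiveDefinite

open scoped ComplexOrder
open Filter Topology

/-- A real function `φ` on a group is positive definite if the kernel `(g, h) ↦ φ (g⁻¹h)` is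
positive semidefinite. -/
def IsPosDef {G : Type*} [Group G] (φ : G → ℝ) : Prop :=
  (Matrix.of fun g h : G => ((φ (g⁻¹ * h) : ℝ) : ℂ)).PosSemidef

variable {G : Type u} [Group G]

theorem IsPosDef.mul {φ ψ : G → ℝ} (hφ : IsPosDef φ) (hψ : IsPosDef ψ) :
    IsPosDef fun g => φ g * ψ g := by
  have e : (Matrix.of fun g h : G => ((φ (g⁻¹ * h) * ψ (g⁻¹ * h) : ℝ) : ℂ)) =
      Matrix.hadamard (Matrix.of fun g h : G => ((φ (g⁻¹ * h) : ℝ) : ℂ))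
        (Matrix.of fun g h : G => ((ψ (g⁻¹ * h) : ℝ) : ℂ)) := by
    ext g k
    simp
  rw [IsPosDef, e]
  exact Matrix.PosSemidef.hadamard hφ hψ

theorem isPosDef_one : IsPosDef fun _ : G => (1 : ℝ) := by
  have h := Matrix.posSemidef_of_inner (X := G) (fun _ => (1 : ℂ))
  rw [IsPosDef]
  convert h using 1
  ext g k
  simp

theorem IsPosDef.pow {φ : G → ℝ} (hφ : IsPosDef φ) (n : ℕ) : IsPosDef fun g => φ g ^ n := by
  induction n with
  | zero => simpa using isPosDef_one
  | succ n ih => simpa [pow_succ] using ih.mul hφ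

theorem IsPosDef.prod {φ : ℕ → G → ℝ} (hφ : ∀ n, IsPosDef (φ n)) (m : ℕ) :
    IsPosDef fun g => ∏ n ∈ Finset.range m, φ n g := by
  induction m with
  | zero => simpa using isPosDef_one
  | succ n ih => simpa [Finset.prod_range_succ] using ih.mul (hφ n)

theorem IsPosDef.of_tendsto {φ : ℕ → G → ℝ} {ψ : G → ℝ} (hφ : ∀ n, IsPosDef (φ n))
    (h : ∀ g, Tendsto (fun n => φ n g) atTop (𝓝 (ψ g))) : IsPosDef ψ :=
  Matrix.PosSemidef.of_tendsto hφ fun _ _ => (Complex.continuous_ofReal.tendsto _).comp (h _)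

theorem IsPosDef.exists_vectors {φ : G → ℝ} (hφ : IsPosDef φ) :
    ∃ (E : Type u) (_ : NormedAddCommGroup E) (_ : InnerProductSpace ℂ E) (_ : CompleteSpace E)
      (x : G → E), (∀ a b, inner ℂ (x a) (x b) = ((φ (a⁻¹ * b) : ℝ) : ℂ)) ∧
        DenseRange (Finsupp.linearCombination ℂ x) :=
  exists_hilbert_of_posSemidef hφ

theorem norm_sq_sub_of_inner {E : Type*} [NormedAddCommGroup E] [InnerProductSpace ℂ E]
    {φ : G → ℝ} (h1 : φ 1 = 1) {x : G → E}
    (hx : ∀ a b, inner ℂ (x a) (x b) = ((φ (a⁻¹ * b) : ℝ) : ℂ)) (a b : G) :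
    ‖x a - x b‖ ^ 2 = 2 * (1 - φ (a⁻¹ * b)) := by
  have hn : ∀ a, ‖x a‖ ^ 2 = 1 := fun a => by
    have h := inner_self_eq_norm_sq (𝕜 := ℂ) (x a)
    rw [hx, inv_mul_cancel, h1] at h
    simpa using h.symm
  rw [norm_sub_sq (𝕜 := ℂ), hn, hn, hx]
  simp
  ring

theorem IsPosDef.le_one {φ : G → ℝ} (hφ : IsPosDef φ) (h1 : φ 1 = 1) (g : G) : φ g ≤ 1 := by
  obtain ⟨E, _, _, _, x, hx, -⟩ := hφ.exists_vectors
  have h := norm_sq_sub_of_inner h1 hx 1 g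
  have h' := sq_nonneg ‖x 1 - x g‖
  rw [h] at h'
  simp at h'
  linarith

theorem IsPosDef.inv {φ : G → ℝ} (hφ : IsPosDef φ) (g : G) : φ g⁻¹ = φ g := by
  have h := hφ.isHermitian.apply 1 g
  simpa using h

theorem IsPosDef.sqrt_one_sub_mul_le {φ : G → ℝ} (hφ : IsPosDef φ) (h1 : φ 1 = 1) (a b : G) :
    √(1 - φ (a * b)) ≤ √(1 - φ a) + √(1 - φ b) := by
  obtain ⟨E, _, _, _, x, hx, -⟩ := hφ.exists_vectors
  have h : ∀ a b, √2 * √(1 - φ (a⁻¹ * b)) = ‖x a - x b‖ := fun a b => by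
    rw [← Real.sqrt_mul zero_le_two, ← norm_sq_sub_of_inner h1 hx, Real.sqrt_sq (norm_nonneg _)]
  have ha := h 1 a
  have hb := h a (a * b)
  have hab := h 1 (a * b)
  simp only [inv_one, one_mul, inv_mul_cancel_left] at ha hb hab
  have ht := norm_sub_le_norm_sub_add_norm_sub (x 1) (x a) (x (a * b))
  rw [← ha, ← hb, ← hab, ← mul_add] at ht
  exact le_of_mul_le_mul_left ht (by positivity)

/-- The representation of `G` obtained from a positive definite function by the
Gelfand–Naimark–Segal construction. -/
theorem IsPosDef.exists_rep {φ : G → ℝ} (hφ : IsPosDef φ) :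
    ∃ (E : Type u) (_ : NormedAddCommGroup E) (_ : InnerProductSpace ℂ E) (_ : CompleteSpace E)
      (π : G →* unitary (E →L[ℂ] E)) (x : G → E),
      (∀ a b, inner ℂ (x a) (x b) = ((φ (a⁻¹ * b) : ℝ) : ℂ)) ∧
        DenseRange (Finsupp.linearCombination ℂ x) ∧
        ∀ g a, (π g : E →L[ℂ] E) (x a) = x (g * a) := by
  obtain ⟨E, _, _, _, x, hx, hd⟩ := hφ.exists_vectors
  have hU : ∀ g : G, ∃ U : E →ₗᵢ[ℂ] E, ∀ a, U (x a) = x (g * a) := fun g =>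
    exists_isometry_of_gram_eq hd fun a b => by rw [hx, hx]; simp [mul_assoc]
  choose U hU using hU
  have hmul : ∀ g h, (U g).toContinuousLinearMap * (U h).toContinuousLinearMap =
      (U (g * h)).toContinuousLinearMap := fun g h =>
    ContinuousLinearMap.eq_of_total hd fun a => by simp [hU, mul_assoc]
  have hone : (U 1).toContinuousLinearMap = 1 :=
    ContinuousLinearMap.eq_of_total hd fun a => by simp [hU]
  have hadj : ∀ g, star (U g).toContinuousLinearMap * (U g).toContinuousLinearMap = 1 := fun g =>
    (ContinuousLinearMap.norm_map_iff_adjoint_comp_self _).1 (U g).norm_map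
  have hinv : ∀ g, star (U g).toContinuousLinearMap = (U g⁻¹).toContinuousLinearMap := fun g =>
    left_inv_eq_right_inv (hadj g) (by rw [hmul, mul_inv_cancel, hone])
  refine ⟨E, inferInstance, inferInstance, inferInstance,
    { toFun := fun g => ⟨(U g).toContinuousLinearMap, Unitary.mem_iff.2 ⟨hadj g, ?_⟩⟩
      map_one' := Subtype.ext hone
      map_mul' := fun g h => Subtype.ext (hmul g h).symm }, x, hx, hd, fun g a => hU g a⟩
  rw [hinv, hmul, mul_inv_cancel, hone]

/-- Since `1 - c n ≤ r * 4⁻ⁿ`, the deviations of the factors `c n ^ 2 ^ n` from `1` sum up to at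
most `2 * r`. -/
theorem one_sub_le_prod_pow {c : ℕ → ℝ} {r : ℝ} (hr : 0 ≤ r) (h0 : ∀ n, 0 ≤ c n)
    (h1 : ∀ n, c n ≤ 1) (h : ∀ n, 1 - r * (1 / 4) ^ n ≤ c n) (m : ℕ) :
    1 - 2 * r ≤ ∏ n ∈ Finset.range m, c n ^ 2 ^ n := by
  suffices 1 - 2 * r * (1 - (1 / 2) ^ m) ≤ ∏ n ∈ Finset.range m, c n ^ 2 ^ n by
    have : (0 : ℝ) ≤ (1 / 2) ^ m := by positivity
    nlinarith
  induction m with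
  | zero => simp
  | succ m ih =>
    rw [Finset.prod_range_succ]
    have hb := one_add_mul_le_pow (a := c m - 1) (by linarith [h0 m]) (2 ^ m)
    have hP1 : ∏ n ∈ Finset.range m, c n ^ 2 ^ n ≤ 1 :=
      Finset.prod_le_one (fun n _ => pow_nonneg (h0 n) _) fun n _ => pow_le_one₀ (h0 n) (h1 n)
    have hc1 : c m ^ 2 ^ m ≤ 1 := pow_le_one₀ (h0 m) (h1 m)
    have e : (2 : ℝ) ^ m * (1 / 4) ^ m = (1 / 2) ^ m := by
      rw [← mul_pow]; norm_num
    have hb' : 1 - r * (1 / 2) ^ m ≤ c m ^ 2 ^ m := by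
      rw [add_sub_cancel] at hb
      refine le_trans ?_ hb
      push_cast
      have := mul_le_mul_of_nonneg_left (h m) (by positivity : (0 : ℝ) ≤ 2 ^ m)
      rw [← e]
      linarith
    have : (1 / 2 : ℝ) ^ (m + 1) = (1 / 2) ^ m / 2 := by rw [pow_succ]; ring
    rw [this]
    nlinarith

/-- A vector orthogonal to every member of a total family vanishes. -/
theorem eq_zero_of_inner_total {X E : Type*} [NormedAddCommGroup E] [InnerProductSpace ℂ E]
    {x : X → E} (hx : DenseRange (Finsupp.linearCombination ℂ x)) {v : E}
    (h : ∀ a, inner ℂ v (x a) = 0) : v = 0 := by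
  refine hx.eq_zero_of_inner_left ℂ fun c => ?_
  simp [Finsupp.linearCombination_apply, Finsupp.sum, inner_sum, inner_smul_right, h]

/-- A bounded sequence converges weakly to zero if it does so against a total family. -/
theorem tendsto_inner_zero_of_total {X E : Type*} [NormedAddCommGroup E] [InnerProductSpace ℂ E]
    {x : X → E} (hx : DenseRange (Finsupp.linearCombination ℂ x)) {y : ℕ → E}
    (hy : ∀ n, ‖y n‖ ≤ 1) (h : ∀ a, Tendsto (fun n => inner ℂ (x a) (y n)) atTop (𝓝 0)) (v : E) :
    Tendsto (fun n => inner ℂ v (y n)) atTop (𝓝 0) := by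
  have hc : ∀ c, Tendsto (fun n => inner ℂ (Finsupp.linearCombination ℂ x c) (y n)) atTop
      (𝓝 0) := fun c => by
    simp only [Finsupp.linearCombination_apply, Finsupp.sum, sum_inner, inner_smul_left]
    simpa using tendsto_finsetSum c.support fun a _ => (h a).const_mul (star (c a))
  rw [Metric.tendsto_atTop]
  intro ε hε
  obtain ⟨c, hcv⟩ := hx.exists_dist_lt v (half_pos hε)
  obtain ⟨N, hN⟩ := Metric.tendsto_atTop.1 (hc c) _ (half_pos hε)
  refine ⟨N, fun n hn => ?_⟩
  have h1 := hN n hn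
  rw [dist_zero_right] at h1 ⊢
  rw [dist_eq_norm] at hcv
  have h2 := norm_inner_le_norm (𝕜 := ℂ) (v - Finsupp.linearCombination ℂ x c) (y n)
  have h3 : ‖v - Finsupp.linearCombination ℂ x c‖ * ‖y n‖ ≤
      ‖v - Finsupp.linearCombination ℂ x c‖ := mul_le_of_le_one_right (norm_nonneg _) (hy n)
  rw [inner_sub_left] at h2
  have h4 := norm_sub_norm_le (inner ℂ v (y n)) (inner ℂ (Finsupp.linearCombination ℂ x c) (y n))
  linarith

/-- Relative property (T) makes positive definite functions that are close to `1` on a suitable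
finite set uniformly close to `1` on `H`. If this fails, there are functions `φ n` converging
rapidly to `1` pointwise and `h n ∈ H` with `φ n (h n)` bounded away from `1`. The
Gelfand–Naimark–Segal representation of `∏ φ n ^ 2 ^ n` then has an almost invariant cyclic vector,
while the operators of the `h n` tend weakly to zero, so there are no nonzero `H`-invariant
vectors. -/
theorem RelativePropertyT.uniform [Countable G] {H : Subgroup G} (hT : RelativePropertyT H)
    {ε : ℝ} (hε : 0 < ε) :
    ∃ (F : Finset G) (δ : ℝ), 0 < δ ∧ ∀ φ : G → ℝ, IsPosDef φ → φ 1 = 1 → (∀ g, 0 ≤ φ g) →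
      (∀ g ∈ F, 1 - δ ≤ φ g) → ∀ h ∈ H, 1 - ε ≤ φ h := by
  classical
  obtain ⟨δ₀, F₀, hδ₀, hT⟩ := hT
  by_contra hcon
  push Not at hcon
  obtain ⟨e, he⟩ := exists_surjective_nat G
  set r : ℝ := δ₀ ^ 2 / 8 with hr
  have hr0 : 0 < r := by positivity
  choose φ hpd hφ1 hφ0 hF h hH hbad using fun n : ℕ =>
    hcon (F₀ ∪ (Finset.range n).image e) (r * (1 / 4) ^ n) (by positivity)
  have hle : ∀ n g, φ n g ≤ 1 := fun n => (hpd n).le_one (hφ1 n)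
  -- the product of the `φ n ^ 2 ^ n`
  let P : ℕ → G → ℝ := fun m g => ∏ n ∈ Finset.range m, φ n g ^ 2 ^ n
  have hP0 : ∀ m g, 0 ≤ P m g := fun m g => Finset.prod_nonneg fun n _ => pow_nonneg (hφ0 n g) _
  have hPanti : ∀ g, Antitone fun m => P m g := fun g => antitone_nat_of_succ_le fun m => by
    simp only [P, Finset.prod_range_succ]
    exact mul_le_of_le_one_right (hP0 m g) (pow_le_one₀ (hφ0 m g) (hle m g))
  have hbdd : ∀ g, BddBelow (Set.range fun m => P m g) := fun g =>
    ⟨0, by rintro _ ⟨m, rfl⟩; exact hP0 m g⟩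
  let Φ : G → ℝ := fun g => ⨅ m, P m g
  have hlim : ∀ g, Tendsto (fun m => P m g) atTop (𝓝 (Φ g)) := fun g =>
    tendsto_atTop_ciInf (hPanti g) (hbdd g)
  have hΦpd : IsPosDef Φ :=
    IsPosDef.of_tendsto (fun m => IsPosDef.prod (fun n => (hpd n).pow (2 ^ n)) m) hlim
  have hΦ0 : ∀ g, 0 ≤ Φ g := fun g => ge_of_tendsto' (hlim g) fun m => hP0 m g
  have hΦ1 : Φ 1 = 1 := by simp [Φ, P, hφ1]
  have hΦF : ∀ g ∈ F₀, 1 - 2 * r ≤ Φ g := fun g hg => ge_of_tendsto' (hlim g) fun m =>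
    one_sub_le_prod_pow hr0.le (fun n => hφ0 n g) (fun n => hle n g)
      (fun n => hF n g (Finset.mem_union_left _ hg)) m
  have hΦle : ∀ n g, Φ g ≤ φ n g ^ 2 ^ n := fun n g => by
    refine (ciInf_le (hbdd g) (n + 1)).trans ?_
    simp only [P, Finset.prod_range_succ]
    exact mul_le_of_le_one_left (pow_nonneg (hφ0 n g) _) <|
      Finset.prod_le_one (fun n _ => pow_nonneg (hφ0 n g) _)
        fun n _ => pow_le_one₀ (hφ0 n g) (hle n g)
  -- translation by `h n` tends to zero
  have hconv : ∀ g, ∀ᶠ n in atTop, √(1 - φ n g) ≤ √ε / 4 := fun g => by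
    obtain ⟨k, rfl⟩ := he g
    have ht : Tendsto (fun n : ℕ => r * (1 / 4 : ℝ) ^ n) atTop (𝓝 0) := by
      simpa using (tendsto_pow_atTop_nhds_zero_of_lt_one (r := (1 / 4 : ℝ)) (by norm_num)
        (by norm_num)).const_mul r
    filter_upwards [eventually_gt_atTop k, ht.eventually_le_const (u := ε / 16) (by positivity)]
      with n hn hn'
    have h1 := hF n (e k)
      (Finset.mem_union_right _ (Finset.mem_image_of_mem _ (Finset.mem_range.2 hn)))
    rw [Real.sqrt_le_left (by positivity), div_pow, Real.sq_sqrt hε.le]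
    linarith
  have hzero : ∀ a g, Tendsto (fun n => Φ (a⁻¹ * (h n * g))) atTop (𝓝 0) := fun a g => by
    set s : ℝ := max 0 (1 - ε / 4) with hs
    have hs0 : 0 ≤ s := le_max_left _ _
    have hs1 : s < 1 := max_lt one_pos (by linarith)
    have ht : Tendsto (fun n : ℕ => s ^ 2 ^ n) atTop (𝓝 0) :=
      (tendsto_pow_atTop_nhds_zero_of_lt_one hs0 hs1).comp
        (tendsto_pow_atTop_atTop_of_one_lt one_lt_two)
    refine tendsto_of_tendsto_of_tendsto_of_le_of_le' tendsto_const_nhds ht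
      (Eventually.of_forall fun n => hΦ0 _) ?_
    filter_upwards [hconv a, hconv g] with n ha hg
    refine (hΦle n _).trans (pow_le_pow_left₀ (hφ0 n _) ?_ _)
    refine le_max_of_le_right ?_
    have h1 := (hpd n).sqrt_one_sub_mul_le (hφ1 n) a (a⁻¹ * h n)
    have h2 := (hpd n).sqrt_one_sub_mul_le (hφ1 n) (a⁻¹ * (h n * g)) g⁻¹
    rw [mul_inv_cancel_left] at h1
    rw [(hpd n).inv, mul_assoc, mul_assoc, mul_inv_cancel, mul_one] at h2
    have h3 : √ε ≤ √(1 - φ n (h n)) := Real.sqrt_le_sqrt (by linarith [hbad n])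
    have h4 : √ε / 2 ≤ √(1 - φ n (a⁻¹ * (h n * g))) := by linarith
    rw [Real.le_sqrt (by positivity) (by linarith [hle n (a⁻¹ * (h n * g))]), div_pow,
      Real.sq_sqrt hε.le] at h4
    linarith
  obtain ⟨E, _, _, _, π, x, hx, hd, hπ⟩ := hΦpd.exists_rep
  have hxn : ∀ a, ‖x a‖ = 1 := fun a => by
    have h := inner_self_eq_norm_sq (𝕜 := ℂ) (x a)
    rw [hx, inv_mul_cancel, hΦ1] at h
    rw [← sq_eq_sq₀ (norm_nonneg _) zero_le_one, ← h]
    simp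
  obtain ⟨η, hη0, hη⟩ := hT E π (x 1) (hxn 1) fun g hg => by
    have h := norm_sq_sub_of_inner hΦ1 hx (g * 1) 1
    rw [hπ]
    rw [mul_one, mul_one, hΦpd.inv] at h
    rw [mul_one, ← sq_lt_sq₀ (norm_nonneg _) hδ₀.le, h]
    have := hΦF g hg
    nlinarith
  refine hη0 (eq_zero_of_inner_total hd fun g => ?_)
  have hinv : ∀ n, inner ℂ η (x (h n * g)) = inner ℂ η (x g) := fun n => by
    rw [← hπ (h n) g]
    nth_rewrite 1 [← hη (h n) (hH n)]
    exact ContinuousLinearMap.inner_map_map_of_mem_unitary (π (h n)).2 η (x g)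
  have ht := tendsto_inner_zero_of_total hd (y := fun n => x (h n * g)) (fun n => (hxn _).le)
    (fun a => by
      simp only [hx]
      exact (Complex.continuous_ofReal.tendsto _).comp (hzero a g)) η
  simp only [hinv] at ht
  exact tendsto_nhds_unique tendsto_const_nhds ht

end PositiveDefinite

/-! ### Fixed points of projective representations near a rank one projection -/

section FixedPoint

open Filter Topology InnerProductSpace

variable {V : Type u} [NormedAddCommGroup V] [InnerProductSpace ℂ V] [CompleteSpace V]

/-- A self-adjoint operator close to a projection has a spectral projection close to it. -/
theorem exists_idempotent_near {T P : V →L[ℂ] V} (hT : IsSelfAdjoint T) (hP : P * P = P)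
    (hP1 : ‖P‖ ≤ 1) (hTP : ‖T - P‖ ≤ 1 / 20) :
    ∃ p : V →L[ℂ] V, p * p = p ∧ ‖p - P‖ < 1 ∧ ∀ b, Commute T b → Commute p b := by
  have hquad : ‖T ^ 2 - T‖ ≤ 31 / 200 := by
    have e : T ^ 2 - T = (T - P) * (T - P) + P * (T - P) + (T - P) * P - (T - P) := by
      have : T ^ 2 - T = (T - P) * (T - P) + P * (T - P) + (T - P) * P - (T - P) +
        (P * P - P) := by noncomm_ring
      rw [this, hP, sub_self, add_zero]
    have h1 : ‖(T - P) * (T - P)‖ ≤ 1 / 20 * (1 / 20) :=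
      (norm_mul_le _ _).trans (mul_le_mul hTP hTP (norm_nonneg _) (by norm_num))
    have h2 : ‖P * (T - P)‖ ≤ 1 * (1 / 20) :=
      (norm_mul_le _ _).trans (mul_le_mul hP1 hTP (norm_nonneg _) (by norm_num))
    have h3 : ‖(T - P) * P‖ ≤ 1 / 20 * 1 :=
      (norm_mul_le _ _).trans (mul_le_mul hTP hP1 (norm_nonneg _) (by norm_num))
    rw [e]
    have h4 := norm_sub_le ((T - P) * (T - P) + P * (T - P) + (T - P) * P) (T - P)
    have h5 := norm_add₃_le (a := (T - P) * (T - P)) (b := P * (T - P)) (c := (T - P) * P)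
    linarith
  have hspec : ∀ x ∈ spectrum ℝ T, |x ^ 2 - x| ≤ 31 / 200 := fun x hx => by
    have h := norm_apply_le_norm_cfc (fun x : ℝ => x ^ 2 - x) T hx
    rw [cfc_sub (fun x : ℝ => x ^ 2) (fun x => x) T, cfc_pow_id T 2, cfc_id' ℝ T] at h
    exact h.trans hquad
  -- `f` vanishes to the left of the spectral gap `(1/4, 3/4)` and is `1` to its right
  let f : ℝ → ℝ := fun x => max 0 (min 1 (2 * x - 1 / 2))
  have hf : Continuous f := by fun_prop
  have hfT : ∀ x ∈ spectrum ℝ T, (x ≤ 1 / 4 ∧ -1 / 4 ≤ x ∧ f x = 0) ∨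
      (3 / 4 ≤ x ∧ x ≤ 5 / 4 ∧ f x = 1) := fun x hx => by
    have h := abs_le.1 (hspec x hx)
    rcases le_total x (1 / 2) with h2 | h2
    · have h3 : x ≤ 1 / 4 := by nlinarith
      refine Or.inl ⟨h3, by nlinarith, ?_⟩
      exact max_eq_left ((min_le_right _ _).trans (by linarith))
    · have h3 : 3 / 4 ≤ x := by nlinarith
      refine Or.inr ⟨h3, by nlinarith, ?_⟩
      simp only [f]
      rw [min_eq_left (by linarith)]
      exact max_eq_right zero_le_one
  refine ⟨cfc f T, ?_, ?_, fun b hb => hb.cfc_real f⟩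
  · rw [← cfc_mul f f T]
    refine cfc_congr fun x hx => ?_
    rcases hfT x hx with ⟨_, _, h⟩ | ⟨_, _, h⟩ <;> simp [h]
  · have h1 : ‖cfc f T - T‖ ≤ 1 / 4 := by
      have e : cfc f T - T = cfc (fun x => f x - x) T := by
        rw [cfc_sub f (fun x => x) T, cfc_id' ℝ T]
      rw [e]
      refine norm_cfc_le (by norm_num) fun x hx => ?_
      rw [Real.norm_eq_abs, abs_le]
      rcases hfT x hx with ⟨_, _, h⟩ | ⟨_, _, h⟩ <;> rw [h] <;> constructor <;> linarith
    have h2 := norm_sub_le_norm_sub_add_norm_sub (cfc f T) T P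
    linarith

/-- An idempotent at distance less than `1` from the projection onto the line of `ξ` has rank
one, so what commutes with it has an eigenvector. -/
theorem exists_eigenvector_of_near_rankOne {T : V →L[ℂ] V} {ξ : V} (hT : IsSelfAdjoint T)
    (hξ : ‖ξ‖ = 1) (h : ‖T - rankOne ℂ ξ ξ‖ ≤ 1 / 20) :
    ∃ η : V, η ≠ 0 ∧ ∀ b : V →L[ℂ] V, Commute T b → ∃ c : ℂ, b η = c • η := by
  obtain ⟨p, hp, hpP, hcomm⟩ := exists_idempotent_near hT (isIdempotentElem_rankOne_self hξ)
    (by simp [hξ]) h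
  have hξξ : inner ℂ ξ ξ = (1 : ℂ) := by rw [inner_self_eq_norm_sq_to_K, hξ]; simp
  have hpp : ∀ v, p (p v) = p v := fun v => DFunLike.congr_fun hp v
  have hne : inner ℂ ξ (p ξ) ≠ (0 : ℂ) := fun h0 => by
    have h1 : ‖(p - rankOne ℂ ξ ξ) ξ‖ < 1 := by
      have := (p - rankOne ℂ ξ ξ).le_opNorm ξ
      rw [hξ, mul_one] at this
      linarith
    have h2 := norm_inner_le_norm (𝕜 := ℂ) ξ ((p - rankOne ℂ ξ ξ) ξ)
    rw [hξ, one_mul, sub_apply, rankOne_apply, hξξ, one_smul, inner_sub_right,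
      h0, hξξ] at h2
    rw [sub_apply, rankOne_apply, hξξ, one_smul] at h1
    norm_num at h2
    linarith
  refine ⟨p ξ, fun h0 => hne (by rw [h0, inner_zero_right]), fun b hb => ?_⟩
  have hbp : p (b ξ) = b (p ξ) := DFunLike.congr_fun (hcomm b hb) ξ
  refine ⟨inner ℂ ξ (p (b ξ)) / inner ℂ ξ (p ξ), ?_⟩
  set c : ℂ := inner ℂ ξ (p (b ξ)) / inner ℂ ξ (p ξ) with hc
  rw [← hbp, ← sub_eq_zero]
  set w := p (b ξ) - c • p ξ with hw
  have hpw : p w = w := by rw [hw, map_sub, map_smul, hpp, hpp]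
  have hPw : rankOne ℂ ξ ξ w = 0 := by
    have : inner ℂ ξ w = (0 : ℂ) := by
      rw [hw, inner_sub_right, inner_smul_right, hc, div_mul_cancel₀ _ hne, sub_self]
    rw [rankOne_apply, this, zero_smul]
  by_contra hw0
  have h1 := (p - rankOne ℂ ξ ξ).le_opNorm w
  rw [sub_apply, hpw, hPw, sub_zero] at h1
  have h2 : 0 < ‖w‖ := norm_pos_iff.2 hw0
  nlinarith

variable {Γ : Type*} [Group Γ]

/-- Let `U s` be isometries that permute the lines of the unit vectors `x g`, as in a projective
representation. If these lines are uniformly close to each other, then the `U s` have a common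
eigenvector: the convex combinations of the rank one projections onto these lines
whose Hilbert–Schmidt norms tend to the infimum converge, by uniform convexity, to an operator that
commutes with all `U s` and is close to a rank one projection. The constant `1 / 800` makes the
Hilbert–Schmidt distance `(2 - 2 * ‖⟪x 1, x g⟫‖ ^ 2) ^ (1 / 2)` of two such projections at most
`1 / 20`, the tolerance of `exists_eigenvector_of_near_rankOne`. -/
theorem exists_common_eigenvector {x : Γ → V} (hx : ∀ g, ‖x g‖ = 1) {U : Γ → V →ₗᵢ[ℂ] V}
    {c : Γ → Γ → ℂ} (hc : ∀ s g, ‖c s g‖ = 1) (hU : ∀ s g, U s (x g) = c s g • x (s * g))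
    (hclose : ∀ g, 1 - 1 / 800 ≤ ‖(inner ℂ (x 1) (x g) : ℂ)‖ ^ 2) :
    ∃ η : V, η ≠ 0 ∧ ∀ s, ∃ z : ℂ, U s η = z • η := by
  obtain ⟨E, _, _, e, he⟩ := exists_hilbertSchmidt V
  let Z : (Γ →₀ ℂ) →ₗ[ℂ] E := Finsupp.linearCombination ℂ fun g => e (x g) (x g)
  let A : (Γ →₀ ℂ) →ₗ[ℂ] (V →L[ℂ] V) := Finsupp.linearCombination ℂ fun g => rankOne ℂ (x g) (x g)
  let Δ : Set (Γ →₀ ℂ) := convexHull ℝ (Set.range fun g => Finsupp.single g (1 : ℂ))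
  have hZs : ∀ g, Z (Finsupp.single g 1) = e (x g) (x g) := fun g => by simp [Z]
  have hAs : ∀ g, A (Finsupp.single g 1) = rankOne ℂ (x g) (x g) := fun g => by simp [A]
  have hee : ∀ a b : V, inner ℂ (e a a) (e b b) = ((‖(inner ℂ a b : ℂ)‖ ^ 2 : ℝ) : ℂ) :=
    fun a b => by
      rw [he, ← inner_conj_symm b a, Complex.mul_conj, Complex.normSq_eq_norm_sq]
  have hen : ∀ a b, ‖e a b‖ = ‖a‖ * ‖b‖ := fun a b => by
    rw [← sq_eq_sq₀ (norm_nonneg _) (by positivity), ← inner_self_eq_norm_sq (𝕜 := ℂ), he,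
      inner_self_eq_norm_sq_to_K, inner_self_eq_norm_sq_to_K, mul_pow]
    norm_cast
  -- the operator norm is at most the Hilbert–Schmidt norm
  have hAZ : ∀ t, ‖A t‖ ≤ ‖Z t‖ := fun t => by
    have hmat : ∀ a b, inner ℂ a (A t b) = inner ℂ (e a b) (Z t) := fun a b => by
      simp only [A, Z, Finsupp.linearCombination_apply, Finsupp.sum, inner_sum, inner_smul_right,
        he, FunLike.coe_sum, Finset.sum_apply, smul_apply,
        rankOne_apply]
      exact Finset.sum_congr rfl fun g _ => by ring
    refine ContinuousLinearMap.opNorm_le_bound _ (norm_nonneg _) fun b => ?_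
    have h1 := norm_inner_le_norm (𝕜 := ℂ) (e (A t b) b) (Z t)
    rw [← hmat, hen, inner_self_eq_norm_sq_to_K, norm_pow] at h1
    simp only [RCLike.norm_ofReal, abs_norm] at h1
    rcases eq_or_lt_of_le (norm_nonneg (A t b)) with h0 | h0
    · rw [← h0]; positivity
    · refine le_of_mul_le_mul_left ?_ h0
      linarith
  let tr : Γ → (Γ →₀ ℂ) →ₗ[ℂ] (Γ →₀ ℂ) := fun s => Finsupp.lmapDomain ℂ ℂ fun g => s * g
  have htrs : ∀ s g, tr s (Finsupp.single g 1) = Finsupp.single (s * g) 1 := fun s g => by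
    simp [tr]
  have hZtr : ∀ s t, ‖Z (tr s t)‖ = ‖Z t‖ := fun s t => by
    have h1 : Z (tr s t) =
        Finsupp.linearCombination ℂ (fun g => e (x (s * g)) (x (s * g))) t := by
      simp only [Z, tr, Finsupp.lmapDomain_apply, Finsupp.linearCombination_mapDomain]
      rfl
    rw [h1, @norm_eq_sqrt_re_inner ℂ, @norm_eq_sqrt_re_inner ℂ, inner_linearCombination,
      inner_linearCombination]
    have h2 : ∀ g k, ‖(inner ℂ (x (s * g)) (x (s * k)) : ℂ)‖ = ‖(inner ℂ (x g) (x k) : ℂ)‖ :=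
      fun g k => by
        rw [← (U s).inner_map_map (x g) (x k), hU, hU, inner_smul_left, inner_smul_right,
          norm_mul, norm_mul, RCLike.norm_conj, hc, hc, one_mul, one_mul]
    simp only [hee, h2]
  have hAtr : ∀ s t, (U s).toContinuousLinearMap * A t =
      A (tr s t) * (U s).toContinuousLinearMap := fun s t => by
    induction t using Finsupp.induction_linear with
    | zero => simp
    | add a b ha hb => simp only [map_add, mul_add, add_mul, ha, hb]
    | single g z =>
      have e1 : Finsupp.single g z = z • Finsupp.single g (1 : ℂ) := by simp
      rw [e1, map_smul, map_smul, map_smul, htrs, hAs, hAs, mul_smul_comm, smul_mul_assoc]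
      congr 1
      ext v
      have h1 : x (s * g) = star (c s g) • U s (x g) := by
        rw [hU, smul_smul, RCLike.star_def, RCLike.conj_mul, hc]
        simp
      simp only [FunLike.coe_mul_eq_comp, Function.comp_apply, rankOne_apply,
        LinearIsometry.coe_toContinuousLinearMap, map_smul]
      rw [h1, inner_smul_left, (U s).inner_map_map, smul_smul]
      congr 1
      rw [mul_right_comm, RCLike.star_def, RCLike.conj_conj, RCLike.mul_conj, hc]
      simp
  have hΔtr : ∀ s, ∀ t ∈ Δ, tr s t ∈ Δ := fun s t ht => by
    have h1 : Δ ⊆ ((tr s).restrictScalars ℝ) ⁻¹' Δ := by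
      refine convexHull_min ?_ ((convex_convexHull ℝ _).linear_preimage _)
      rintro _ ⟨g, rfl⟩
      change tr s _ ∈ Δ
      rw [htrs]
      exact subset_convexHull ℝ _ ⟨_, rfl⟩
    exact h1 ht
  have hΔsa : ∀ t ∈ Δ, IsSelfAdjoint (A t) := fun t ht => by
    have h1 : Δ ⊆ (A.restrictScalars ℝ) ⁻¹' {T | IsSelfAdjoint T} := by
      refine convexHull_min ?_ (Convex.linear_preimage ?_ _)
      · rintro _ ⟨g, rfl⟩
        change IsSelfAdjoint (A _)
        rw [hAs]
        exact (isStarProjection_rankOne_self (hx g)).isSelfAdjoint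
      · exact (selfAdjoint.submodule ℝ (V →L[ℂ] V)).convex
    exact h1 ht
  have hΔnear : ∀ t ∈ Δ, ‖A t - rankOne ℂ (x 1) (x 1)‖ ≤ 1 / 20 := fun t ht => by
    have h1 : Δ ⊆ (Z.restrictScalars ℝ) ⁻¹' (Metric.closedBall (e (x 1) (x 1)) (1 / 20)) := by
      refine convexHull_min ?_ ((convex_closedBall _ _).linear_preimage _)
      rintro _ ⟨g, rfl⟩
      change Z _ ∈ Metric.closedBall _ _
      have h2 := norm_sub_sq (𝕜 := ℂ) (e (x 1) (x 1)) (e (x g) (x g))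
      rw [hen, hen, hee, hx, hx, RCLike.re_to_complex, Complex.ofReal_re] at h2
      rw [Metric.mem_closedBall, dist_comm, dist_eq_norm, hZs,
        ← sq_le_sq₀ (norm_nonneg _) (by norm_num)]
      have := hclose g
      linarith
    have h2 := h1 ht
    rw [Set.mem_preimage, Metric.mem_closedBall, dist_eq_norm] at h2
    rw [← hAs, ← map_sub]
    refine (hAZ _).trans ?_
    rw [map_sub, hZs]
    exact h2
  -- near the infimum of the norm, points of `Δ` are close to each other by the parallelogram law
  have hne : ((fun t => ‖Z t‖ ^ 2) '' Δ).Nonempty :=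
    ⟨_, _, subset_convexHull ℝ _ ⟨1, rfl⟩, rfl⟩
  have hbdd : BddBelow ((fun t => ‖Z t‖ ^ 2) '' Δ) :=
    ⟨0, by rintro _ ⟨t, -, rfl⟩; positivity⟩
  set D := sInf ((fun t => ‖Z t‖ ^ 2) '' Δ) with hD
  have hDle : ∀ t ∈ Δ, D ≤ ‖Z t‖ ^ 2 := fun t ht => csInf_le hbdd ⟨t, ht, rfl⟩
  have hunif : ∀ r : ℝ, 0 ≤ r → ∀ t ∈ Δ, ∀ t' ∈ Δ, ‖Z t‖ ^ 2 ≤ D + r ^ 2 / 4 →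
      ‖Z t'‖ ^ 2 ≤ D + r ^ 2 / 4 → ‖A t - A t'‖ ≤ r := fun r hr t ht t' ht' h h' => by
    rw [← map_sub]
    refine (hAZ _).trans ?_
    rw [map_sub, ← sq_le_sq₀ (norm_nonneg _) hr]
    have hm : (1 / 2 : ℝ) • t + (1 / 2 : ℝ) • t' ∈ Δ :=
      convex_convexHull ℝ _ ht ht' (by norm_num) (by norm_num) (by norm_num)
    have h1 := hDle _ hm
    have h2 : Z ((1 / 2 : ℝ) • t + (1 / 2 : ℝ) • t') = (1 / 2 : ℝ) • (Z t + Z t') := by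
      rw [← smul_add, ← map_add]
      exact (Z.restrictScalars ℝ).map_smul (1 / 2) (t + t')
    rw [h2, norm_smul, mul_pow] at h1
    have h3 := parallelogram_law_with_norm ℂ (Z t) (Z t')
    norm_num at h1
    nlinarith
  have hseq : ∀ n : ℕ, ∃ t ∈ Δ, ‖Z t‖ ^ 2 ≤ D + ((1 / 2 : ℝ) ^ n) ^ 2 / 4 := fun n => by
    have hpos : (0 : ℝ) < ((1 / 2 : ℝ) ^ n) ^ 2 / 4 := by positivity
    obtain ⟨_, ⟨t, ht, rfl⟩, h⟩ := exists_lt_of_csInf_lt hne (lt_add_of_pos_right D hpos)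
    exact ⟨t, ht, h.le⟩
  choose t htΔ ht using hseq
  have hlim0 : Tendsto (fun n : ℕ => (1 / 2 : ℝ) ^ n) atTop (𝓝 0) :=
    tendsto_pow_atTop_nhds_zero_of_lt_one (by norm_num) (by norm_num)
  have hcauchy : CauchySeq fun n => A (t n) := by
    refine cauchySeq_of_le_tendsto_0 (fun n : ℕ => (1 / 2 : ℝ) ^ n) (fun n m N hn hm => ?_) hlim0
    have hmono : ∀ k, N ≤ k → ‖Z (t k)‖ ^ 2 ≤ D + ((1 / 2 : ℝ) ^ N) ^ 2 / 4 := fun k hk => by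
      refine (ht k).trans ?_
      have : (1 / 2 : ℝ) ^ k ≤ (1 / 2 : ℝ) ^ N :=
        pow_le_pow_of_le_one (by norm_num) (by norm_num) hk
      gcongr
    rw [dist_eq_norm]
    exact hunif _ (by positivity) _ (htΔ n) _ (htΔ m) (hmono n hn) (hmono m hm)
  obtain ⟨T, hT⟩ := cauchySeq_tendsto_of_complete hcauchy
  have hTsa : IsSelfAdjoint T :=
    (isClosed_eq continuous_star continuous_id).mem_of_tendsto hT
      (Eventually.of_forall fun n => hΔsa _ (htΔ n))
  have hTnear : ‖T - rankOne ℂ (x 1) (x 1)‖ ≤ 1 / 20 :=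
    le_of_tendsto' (hT.sub_const _).norm fun n => hΔnear _ (htΔ n)
  have hTU : ∀ s, Commute T (U s).toContinuousLinearMap := fun s => by
    have h1 : Tendsto (fun n => A (tr s (t n)) - A (t n)) atTop (𝓝 0) :=
      squeeze_zero_norm (fun n => hunif _ (by positivity) _ (hΔtr s _ (htΔ n)) _ (htΔ n)
        (by rw [hZtr]; exact ht n) (ht n)) hlim0
    have h2 : Tendsto (fun n => A (tr s (t n))) atTop (𝓝 T) := by
      simpa using h1.add hT
    have h3 := hT.const_mul (U s).toContinuousLinearMap
    have h4 := h2.mul_const (U s).toContinuousLinearMap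
    simp only [hAtr] at h3
    exact tendsto_nhds_unique h4 h3
  obtain ⟨η, hη, h⟩ := exists_eigenvector_of_near_rankOne hTsa (hx 1) hTnear
  exact ⟨η, hη, fun s => h _ (hTU s)⟩

end FixedPoint

/-! ### Twisted kernels and coboundaries -/

section TwistedKernel

open scoped ComplexOrder ComplexConjugate

variable {G : Type u} [Group G]

/-- The squared absolute value of a kernel that is equivariant up to phases `w` comes from a
positive definite function on the group. -/
theorem isPosDef_of_twisted_kernel {w : G → G → Circle} {k : Matrix G G ℂ} (hk : k.PosSemidef)
    (hw : ∀ s g h, conj (w s g : ℂ) * w s h * k (s * g) (s * h) = k g h) (r : ℝ) :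
    IsPosDef fun g => r ^ 2 * ‖k 1 g‖ ^ 2 := by
  have hnorm : ∀ g h, ‖k 1 (g⁻¹ * h)‖ = ‖k g h‖ := fun g h => by
    have h1 := congrArg norm (hw g 1 (g⁻¹ * h))
    simpa [Circle.norm_coe] using h1.symm
  have h1 := ((hk.hadamard hk.transpose).smul (a := r ^ 2) (sq_nonneg r))
  have e : (Matrix.of fun g h : G => ((r ^ 2 * ‖k 1 (g⁻¹ * h)‖ ^ 2 : ℝ) : ℂ)) =
      r ^ 2 • Matrix.hadamard k k.transpose := by
    ext g h
    have h2 : k h g = conj (k g h) := (hk.isHermitian.apply h g).symm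
    simp only [Matrix.of_apply, Matrix.smul_apply, Matrix.hadamard_apply, Matrix.transpose_apply,
      h2, Complex.mul_conj, hnorm, Complex.real_smul, Complex.normSq_eq_norm_sq]
    push_cast
    ring
  rw [IsPosDef, e]
  exact h1

/-- A cocycle `w` that is the phase of an equivariant kernel with nearly constant absolute value
is a coboundary, as it is the cocycle of a projective representation with a common eigenvector. -/
theorem exists_coboundary_of_twisted_kernel {w : Z2 G} {k : Matrix G G ℂ} (hk : k.PosSemidef)
    (hw : ∀ s g h, conj (w.1 s g : ℂ) * w.1 s h * k (s * g) (s * h) = k g h)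
    (hk1 : k 1 1 = 1) (hclose : ∀ g, 1 - 1 / 800 ≤ ‖k 1 g‖ ^ 2) :
    w ∈ (coboundaryHom G).range := by
  obtain ⟨V, _, _, _, x, hx, hd⟩ := exists_hilbert_of_posSemidef hk
  have hkg : ∀ g, k g g = 1 := fun g => by
    have h := hw g 1 1
    rw [mul_one, hk1, RCLike.conj_mul, Circle.norm_coe] at h
    simpa using h
  have hxn : ∀ g, ‖x g‖ = 1 := fun g => by
    have h := inner_self_eq_norm_sq (𝕜 := ℂ) (x g)
    rw [hx, hkg] at h
    rw [← sq_eq_sq₀ (norm_nonneg _) zero_le_one, ← h]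
    simp
  have hU : ∀ s : G, ∃ U : V →ₗᵢ[ℂ] V, ∀ a, U (x a) = (w.1 s a : ℂ) • x (s * a) := fun s =>
    exists_isometry_of_gram_eq hd fun a b => by
      rw [inner_smul_left, inner_smul_right, hx, hx, ← mul_assoc, hw]
  choose U hU using hU
  obtain ⟨η, hη, hev⟩ := exists_common_eigenvector hxn (U := U) (c := fun s g => (w.1 s g : ℂ))
    (fun s g => Circle.norm_coe _) hU fun g => by rw [hx]; exact hclose g
  choose z hz using hev
  have hz1 : ∀ s, ‖z s‖ = 1 := fun s => by
    have h := (U s).norm_map η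
    rw [hz, norm_smul] at h
    exact (mul_eq_right₀ (norm_ne_zero_iff.2 hη)).1 h
  have hmul : ∀ s t, z s * z t = w.1 s t * z (s * t) := fun s t => by
    have h : (U s).toContinuousLinearMap * (U t).toContinuousLinearMap =
        (w.1 s t : ℂ) • (U (s * t)).toContinuousLinearMap :=
      ContinuousLinearMap.eq_of_total hd fun a => by
        have h1 := congrArg (fun c : Circle => (c : ℂ)) (w.2 s t a)
        simp only [Circle.coe_mul] at h1
        simp only [FunLike.coe_mul_eq_comp, Function.comp_apply, smul_apply,
          LinearIsometry.coe_toContinuousLinearMap, hU, map_smul, smul_smul, h1, mul_assoc]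
    have h2 := DFunLike.congr_fun h η
    simp only [FunLike.coe_mul_eq_comp, Function.comp_apply, smul_apply,
      LinearIsometry.coe_toContinuousLinearMap, hz, map_smul, smul_smul] at h2
    rw [mul_comm]
    exact smul_left_injective ℂ hη h2
  let l : G → Circle := fun s => ⟨z s, mem_sphere_zero_iff_norm.2 (hz1 s)⟩
  have hl : ∀ s t, l s * l t = w.1 s t * l (s * t) := fun s t => Circle.ext (hmul s t)
  refine ⟨l, Subtype.ext ?_⟩
  funext s t
  change l s * l t * (l (s * t))⁻¹ = w.1 s t
  rw [hl, mul_inv_cancel_right]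

end TwistedKernel

/-! ### Projective representations in tracial algebras -/

section Tracial

open scoped ComplexOrder ComplexConjugate

variable {G : Type u} [Group G] {A : Type*} [Ring A] [StarRing A] [Algebra ℂ A]

/-- `u` is a projective unitary representation of `G` with cocycle `μ` in the corner `pAp` of a
`*`-algebra `A`. -/
structure IsProjRep (μ : G → G → Circle) (p : A) (u : G → A) : Prop where
  mul : ∀ g h, u g * u h = (μ g h : ℂ) • u (g * h)
  star_mul_self : ∀ g, star (u g) * u g = p
  mul_star_self : ∀ g, u g * star (u g) = p
  proj_mul : ∀ g, p * u g = u g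

namespace IsProjRep

variable {μ : G → G → Circle} {p : A} {u : G → A}

theorem star_proj (hu : IsProjRep μ p u) : star p = p := by
  rw [← hu.star_mul_self 1, star_mul, star_star]

theorem proj_mul_proj (hu : IsProjRep μ p u) : p * p = p := by
  nth_rewrite 2 [← hu.mul_star_self 1]
  rw [← mul_assoc, hu.proj_mul, hu.mul_star_self]

theorem star_mul_proj (hu : IsProjRep μ p u) (g : G) : star (u g) * p = star (u g) := by
  rw [← hu.star_proj, ← star_mul, hu.proj_mul]

theorem star_mul_mul [StarModule ℂ A] (hu : IsProjRep μ p u) (g h : G) :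
    star (u g) * u (g * h) = conj (μ g h : ℂ) • u h := by
  have h1 : u (g * h) = conj (μ g h : ℂ) • (u g * u h) := by
    rw [hu.mul, smul_smul, RCLike.conj_mul, Circle.norm_coe]
    simp
  rw [h1, mul_smul_comm, ← mul_assoc, hu.star_mul_self, hu.proj_mul]

end IsProjRep

/-- A finite trace on a `*`-algebra: a positive linear functional with `τ (yz) = τ (zy)`. -/
structure IsTrace (τ : A →ₗ[ℂ] ℂ) : Prop where
  nonneg : ∀ y, 0 ≤ τ (star y * y)
  comm : ∀ y z, τ (y * z) = τ (z * y)

namespace IsTrace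

variable {τ : A →ₗ[ℂ] ℂ}

theorem posSemidef [StarModule ℂ A] (hτ : IsTrace τ) {X : Type*} (y : X → A) :
    (Matrix.of fun g h => τ (star (y g) * y h)).PosSemidef := by
  have hconj : ∀ a b, conj (τ (star a * b)) = τ (star b * a) := fun a b => by
    have h0 := fun c => Complex.conj_eq_iff_im.2 (Complex.le_def.1 (hτ.nonneg c)).2.symm
    have h1 := h0 (a + b)
    have h2 := h0 (a + Complex.I • b)
    simp only [star_add, star_smul, mul_add, add_mul, map_add, smul_mul_assoc, mul_smul_comm,
      map_smul, smul_eq_mul, map_mul, h0, Complex.conj_I, RCLike.star_def, map_neg, neg_mul,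
      neg_neg] at h1 h2
    have h3 := congrArg (fun z => Complex.I * z) h2
    simp only [mul_add, mul_neg, ← mul_assoc, Complex.I_mul_I, neg_mul, one_mul, neg_neg] at h3
    linear_combination (h1 + h3) / 2
  refine ⟨Matrix.ext fun a b => hconj _ _, fun c => ?_⟩
  have e : (c.sum fun i r => c.sum fun j s =>
      star r * (Matrix.of fun g h => τ (star (y g) * y h)) i j * s) =
      τ (star (Finsupp.linearCombination ℂ y c) * Finsupp.linearCombination ℂ y c) := by
    simp only [Finsupp.linearCombination_apply, Finsupp.sum, star_sum, Finset.sum_mul,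
      Finset.mul_sum, map_sum, star_smul, smul_mul_assoc, mul_smul_comm, map_smul, smul_eq_mul,
      Matrix.of_apply]
    refine Finset.sum_comm.trans ?_
    exact Finset.sum_congr rfl fun i _ => Finset.sum_congr rfl fun j _ => by ring
  rw [e]
  exact hτ.nonneg _

end IsTrace

/-- Two projective representations `u`, `v` in a tracial algebra, with cocycles `μ` and `ν`, give
the equivariant kernel `τ (y g)* (y h)` for `y g = u g * (v g)*`, whose phase is the cocycle
`ν⁻¹ * μ`. If `τ ((v g)* u g)` is close to `τ p = 1` on a suitable finite set, then by relative
property (T) the kernel has nearly constant absolute value on `H`, so `μ` and `ν` are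
cohomologous on `H`. -/
theorem res_eq_of_close (A : Type*) [Ring A] [StarRing A] [Algebra ℂ A] [StarModule ℂ A]
    [Countable G] {H : Subgroup G} (hT : RelativePropertyT H) :
    ∃ (F : Finset G) (δ : ℝ), 0 < δ ∧
      ∀ (τ : A →ₗ[ℂ] ℂ) (_ : IsTrace τ) (μ ν : Z2 G) (p q : A) (u v : G → A) (_ : IsProjRep μ.1 p u)
        (_ : IsProjRep ν.1 q v) (_ : τ p = 1) (_ : ∀ g ∈ F, 1 - δ ≤ ‖τ (star (v g) * u g)‖),
        H2.res H (μ : H2 G) = H2.res H (ν : H2 G) := by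
  classical
  obtain ⟨F, δ, hδ, hF⟩ := hT.uniform (ε := 1 / 800) (by norm_num)
  refine ⟨insert 1 F, min (1 / 2) (δ / 2), by positivity, ?_⟩
  intro τ hτ μ ν p q u v hu hv hp hclose
  let y : G → A := fun g => u g * star (v g)
  let k : Matrix G G ℂ := Matrix.of fun g h => τ (star (y g) * y h)
  have hk : k.PosSemidef := hτ.posSemidef y
  have hkapp : ∀ g h, k g h = τ (v g * star (u g) * (u h * star (v h))) := fun g h => by
    simp [k, y]
  let w : Z2 G := ν⁻¹ * μ
  have hwapp : ∀ s g, (w.1 s g : ℂ) = conj (ν.1 s g : ℂ) * μ.1 s g := fun s g => by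
    change (((ν.1 s g)⁻¹ * μ.1 s g : Circle) : ℂ) = _
    rw [Circle.coe_mul, Circle.coe_inv_eq_conj]
  have hy : ∀ s g, (w.1 s g : ℂ) • y (s * g) = u s * y g * star (v s) := fun s g => by
    have h1 : u s * y g * star (v s) = (u s * u g) * star (v s * v g) := by
      simp only [y, star_mul, mul_assoc]
    rw [h1, hu.mul, hv.mul, star_smul, smul_mul_smul_comm, hwapp, mul_comm (conj _)]
    rfl
  have hw : ∀ s g h, conj (w.1 s g : ℂ) * w.1 s h * k (s * g) (s * h) = k g h := fun s g h => by
    have h1 : conj (w.1 s g : ℂ) * w.1 s h * k (s * g) (s * h) =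
        τ (star ((w.1 s g : ℂ) • y (s * g)) * ((w.1 s h : ℂ) • y (s * h))) := by
      rw [star_smul, smul_mul_smul_comm, map_smul]
      rfl
    have h2 : star (u s * y g * star (v s)) * (u s * y h * star (v s)) =
        v s * (star (y g) * (p * y h) * star (v s)) := by
      simp only [star_mul, star_star, ← hu.star_mul_self s, mul_assoc]
    have h3 : p * y h = y h := by simp only [y, ← mul_assoc, hu.proj_mul]
    have h4 : y h * q = y h := by simp only [y, mul_assoc, hv.star_mul_proj]
    rw [h1, hy, hy, h2, hτ.comm, mul_assoc, hv.star_mul_self, h3, mul_assoc, h4]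
    rfl
  -- the diagonal entry is at most `1`, and the entries `k 1 g` are nearly `1` in absolute value
  have hk1 : ∀ g, ‖k 1 g‖ = ‖τ (star (v g) * u g)‖ := fun g => by
    have h1 := hu.star_mul_mul 1 g
    have h2 := congrArg star (hv.star_mul_mul 1 g)
    rw [one_mul] at h1 h2
    rw [star_mul, star_star, star_smul, RCLike.star_def, RCLike.conj_conj] at h2
    have h3 : τ (v 1 * star (u 1) * (u g * star (v g))) =
        τ ((star (u 1) * u g) * (star (v g) * v 1)) := by
      rw [mul_assoc, hτ.comm]
      simp only [mul_assoc]
    rw [hkapp, h3, h1, h2, smul_mul_smul_comm, map_smul, smul_eq_mul, norm_mul, norm_mul,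
      RCLike.norm_conj, Circle.norm_coe, Circle.norm_coe, hτ.comm, one_mul, one_mul]
  have hk11 : k 1 1 = τ (q * p) := by
    rw [hkapp, mul_assoc, hτ.comm, mul_assoc, mul_assoc, hv.star_mul_self, ← mul_assoc,
      hu.star_mul_self, hτ.comm]
  have hle : (k 1 1).re ≤ 1 := by
    have h1 := hτ.nonneg (p - q * p)
    have h2 : star (p - q * p) * (p - q * p) = p - p * (q * p) := by
      rw [star_sub, star_mul, hu.star_proj, hv.star_proj]
      have e1 : p * q * (q * p) = p * (q * p) := by
        rw [mul_assoc, ← mul_assoc q, hv.proj_mul_proj]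
      rw [sub_mul, mul_sub, mul_sub, hu.proj_mul_proj, e1, mul_assoc, sub_self, sub_zero]
    rw [h2, map_sub, hτ.comm p, mul_assoc, hu.proj_mul_proj, hp, ← hk11] at h1
    have h3 := (Complex.le_def.1 h1).1
    simpa using h3
  have hk0 : 0 ≤ k 1 1 := hτ.nonneg _
  set a : ℝ := (k 1 1).re with ha
  have hka : k 1 1 = (a : ℂ) := (Complex.ext rfl (by simpa using (Complex.le_def.1 hk0).2.symm))
  have ha0 : 0 ≤ a := (Complex.le_def.1 hk0).1
  have hapos : 0 < a := by
    have h1 := hclose 1 (Finset.mem_insert_self _ _)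
    rw [← hk1, hka, Complex.norm_real, Real.norm_of_nonneg ha0] at h1
    have := min_le_left (1 / 2) (δ / 2)
    linarith
  have hφ := hF (fun g => a⁻¹ ^ 2 * ‖k 1 g‖ ^ 2) (isPosDef_of_twisted_kernel hk hw a⁻¹)
    (by
      simp only [hka, Complex.norm_real, Real.norm_of_nonneg ha0]
      rw [← mul_pow, inv_mul_cancel₀ hapos.ne', one_pow])
    (fun g => by positivity)
    (fun g hg => by
      have h1 := hclose g (Finset.mem_insert_of_mem hg)
      rw [← hk1] at h1
      have h2 := min_le_left (1 / 2) (δ / 2)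
      have h3 := min_le_right (1 / 2) (δ / 2)
      have h4 : 1 ≤ a⁻¹ := (one_le_inv₀ hapos).2 hle
      have h5 : 1 - δ / 2 ≤ a⁻¹ * ‖k 1 g‖ := by nlinarith [norm_nonneg (k 1 g)]
      rw [← mul_pow]
      have h6 : 0 ≤ a⁻¹ * ‖k 1 g‖ := by positivity
      nlinarith [sq_nonneg (a⁻¹ * ‖k 1 g‖ - 1)])
  -- the restriction of the normalized kernel to `H`
  have hcob : Z2.res H w ∈ (coboundaryHom H).range := by
    refine exists_coboundary_of_twisted_kernel
      (k := a⁻¹ • k.submatrix (fun h : H => (h : G)) fun h : H => (h : G))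
      ((hk.submatrix _).smul (inv_nonneg.2 ha0)) (fun s g h => ?_) ?_ fun g => ?_
    · have h1 := hw s g h
      simp only [Matrix.smul_apply, Matrix.submatrix_apply, Subgroup.coe_mul, mul_smul_comm]
      rw [← h1]
      rfl
    · simp only [Matrix.smul_apply, Matrix.submatrix_apply, Subgroup.coe_one, hka]
      rw [Complex.real_smul, ← Complex.ofReal_mul, inv_mul_cancel₀ hapos.ne', Complex.ofReal_one]
    · have h1 := hφ g g.2
      simp only [Matrix.smul_apply, Matrix.submatrix_apply, Subgroup.coe_one, norm_smul, mul_pow,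
        norm_inv, Real.norm_of_nonneg ha0]
      simpa using h1
  refine Eq.symm (QuotientGroup.eq.2 ?_)
  exact hcob

end Tracial

/-! ### The projective regular representation and its embeddings -/

section Regular

variable {G : Type*} [Group G]

theorem twistedTranslation_apply (μ : G → G → Circle) (g : G) (f : L2G G) (k : G) :
    twistedTranslation μ g f k = (μ g (g⁻¹ * k) : ℂ) * f (g⁻¹ * k) := rfl

theorem twistedTranslation_mul (μ : Z2 G) (g h : G) :
    twistedTranslation μ.1 g * twistedTranslation μ.1 h =
      (μ.1 g h : ℂ) • twistedTranslation μ.1 (g * h) := by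
  ext f k
  have h1 := congrArg (fun c : Circle => (c : ℂ)) (μ.2 g h (h⁻¹ * (g⁻¹ * k)))
  simp only [Circle.coe_mul, mul_inv_cancel_left] at h1
  change (μ.1 g (g⁻¹ * k) : ℂ) * ((μ.1 h (h⁻¹ * (g⁻¹ * k)) : ℂ) * f (h⁻¹ * (g⁻¹ * k))) =
    (μ.1 g h : ℂ) * ((μ.1 (g * h) ((g * h)⁻¹ * k) : ℂ) * f ((g * h)⁻¹ * k))
  rw [mul_inv_rev, mul_assoc h⁻¹]
  linear_combination -(f (h⁻¹ * (g⁻¹ * k))) * h1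

theorem star_twistedTranslation_mul_self (μ : G → G → Circle) (g : G) :
    star (twistedTranslation μ g) * twistedTranslation μ g = 1 :=
  (ContinuousLinearMap.norm_map_iff_adjoint_comp_self _).1 fun f => by
    rw [twistedTranslation, LinearIsometry.coe_toContinuousLinearMap, LinearIsometry.norm_map]

theorem twistedTranslation_mul_star_self (μ : Z2 G) (g : G) :
    twistedTranslation μ.1 g * star (twistedTranslation μ.1 g) = 1 := by
  -- `μ 1 k` does not depend on `k`, so the operator at `1` is a scalar
  have h1 : twistedTranslation μ.1 1 = (μ.1 1 1 : ℂ) • 1 := by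
    ext f k
    have h := μ.2 1 1 k
    rw [one_mul, one_mul, mul_comm (μ.1 1 k), mul_left_inj] at h
    change (μ.1 1 (1⁻¹ * k) : ℂ) * f (1⁻¹ * k) = (μ.1 1 1 : ℂ) * f k
    rw [inv_one, one_mul, h]
  have h2 : twistedTranslation μ.1 g *
      (((μ.1 g g⁻¹ * μ.1 1 1)⁻¹ : Circle) • twistedTranslation μ.1 g⁻¹) = 1 := by
    have h3 : (((μ.1 g g⁻¹ * μ.1 1 1)⁻¹ : Circle) • twistedTranslation μ.1 g⁻¹) =
      (((μ.1 g g⁻¹ * μ.1 1 1)⁻¹ : Circle) : ℂ) • twistedTranslation μ.1 g⁻¹ := rfl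
    rw [h3, mul_smul_comm, twistedTranslation_mul, mul_inv_cancel, h1, smul_smul, smul_smul,
      ← Circle.coe_mul, ← Circle.coe_mul, mul_assoc, inv_mul_cancel, Circle.coe_one, one_smul]
  have h4 := left_inv_eq_right_inv (star_twistedTranslation_mul_self μ.1 g) h2
  rw [h4, h2]

theorem twistedTranslation_mem (μ : Z2 G) (g : G) :
    twistedTranslation μ.1 g ∈ (twistedGroupVN μ).toStarSubalgebra := by
  change _ ∈ StarSubalgebra.centralizer ℂ
    (StarSubalgebra.centralizer ℂ (Set.range (twistedTranslation μ.1)) : Set (L2G G →L[ℂ] L2G G))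
  rw [StarSubalgebra.mem_centralizer_iff]
  intro x hx
  have h1 := (StarSubalgebra.mem_centralizer_iff ℂ).1 hx _ ⟨g, rfl⟩
  have h2 := (StarSubalgebra.mem_centralizer_iff ℂ).1 (star_mem hx) _ ⟨g, rfl⟩
  exact ⟨h1.1.symm, h2.1.symm⟩

/-- The canonical unitaries of the twisted group von Neumann algebra. -/
noncomputable def canonicalUnitary (μ : Z2 G) (g : G) : (twistedGroupVN μ).toStarSubalgebra :=
  ⟨twistedTranslation μ.1 g, twistedTranslation_mem μ g⟩

theorem canonicalUnitary_isProjRep (μ : Z2 G) : IsProjRep μ.1 1 (canonicalUnitary μ) where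
  mul g h := Subtype.ext (twistedTranslation_mul μ g h)
  star_mul_self g := Subtype.ext (star_twistedTranslation_mul_self μ.1 g)
  mul_star_self g := Subtype.ext (twistedTranslation_mul_star_self μ g)
  proj_mul _ := one_mul _

/-- A normal functional is a sum of vector functionals, and every vector of `ℓ²(G)` has countable
support, so all but countably many canonical unitaries are in its kernel. -/
theorem IsNormalFunctional.countable_canonicalUnitary {μ : Z2 G}
    {f : (twistedGroupVN μ).toStarSubalgebra →ₗ[ℂ] ℂ}
    (hf : IsNormalFunctional (twistedGroupVN μ) f) :
    {g | f (canonicalUnitary μ g) ≠ 0}.Countable := by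
  obtain ⟨ξ, η, -, -, hf⟩ := hf
  have hsupp : ∀ a : L2G G, {k | a k ≠ 0}.Countable := fun a => by
    have h := (lp.hasSum_norm (p := 2) (by norm_num) a).summable.countable_support
    refine h.mono fun k hk => ?_
    simpa using hk
  let S : Set G := ⋃ n, ({k | ξ n k ≠ 0} ∪ {k | η n k ≠ 0})
  have hS : S.Countable := Set.countable_iUnion fun n => (hsupp _).union (hsupp _)
  refine (hS.image2 hS fun a b => a * b⁻¹).mono fun g hg => ?_
  have h1 : ∃ n, inner ℂ (ξ n) (twistedTranslation μ.1 g (η n)) ≠ 0 := by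
    by_contra hcon
    push Not at hcon
    have h2 := hf (canonicalUnitary μ g)
    have h3 : (fun n => inner ℂ (ξ n)
        ((canonicalUnitary μ g : L2G G →L[ℂ] L2G G) (η n))) = fun _ => 0 := funext hcon
    rw [h3] at h2
    exact hg (h2.unique hasSum_zero)
  obtain ⟨n, hn⟩ := h1
  have h2 : ∃ k, inner ℂ (ξ n k) (twistedTranslation μ.1 g (η n) k) ≠ 0 := by
    by_contra hcon
    push Not at hcon
    exact hn (by rw [lp.inner_eq_tsum]; simp only [hcon, tsum_zero])
  obtain ⟨k, hk⟩ := h2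
  refine ⟨k, Set.mem_iUnion.2 ⟨n, Or.inl fun h => hk (by rw [h, inner_zero_left])⟩,
    g⁻¹ * k, Set.mem_iUnion.2 ⟨n, Or.inr fun h => hk ?_⟩, by simp⟩
  rw [twistedTranslation_apply, h, mul_zero, inner_zero_right]

end Regular

section Embedding

open scoped ComplexOrder

variable {G : Type u} [Group G] {K : Type*} [NormedAddCommGroup K] [InnerProductSpace ℂ K]
  [CompleteSpace K] {M : VonNeumannAlgebra K}

theorem IsNormalFunctional.smul_mul {f : M.toStarSubalgebra →ₗ[ℂ] ℂ} (hf : IsNormalFunctional M f)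
    (c : ℂ) (a : M.toStarSubalgebra) :
    IsNormalFunctional M (c • f ∘ₗ LinearMap.mulRight ℂ a) := by
  obtain ⟨ξ, η, hξ, hη, h⟩ := hf
  refine ⟨ξ, fun n => c • (a : K →L[ℂ] K) (η n), hξ, ?_, fun x => ?_⟩
  · refine Summable.of_nonneg_of_le (fun n => sq_nonneg _) (fun n => ?_)
      (hη.mul_left ((‖c‖ * ‖(a : K →L[ℂ] K)‖) ^ 2))
    rw [← mul_pow, norm_smul, mul_assoc]
    gcongr
    exact (a : K →L[ℂ] K).le_opNorm _
  · have h1 := (h (x * a)).mul_left c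
    simpa [inner_smul_right] using h1

/-- What an embedding of a twisted group von Neumann algebra into a finite `M` provides: a
projective representation of `G` in a corner of `M`, and a normal trace `τ` that is normalized on
this corner and vanishes on all but countably many of its unitaries. -/
theorem EmbedsVN.exists_isProjRep {μ : Z2 G} (h : EmbedsVN (twistedGroupVN μ) M)
    (hfin : IsFiniteVN M) :
    ∃ (p : M.toStarSubalgebra) (u : G → M.toStarSubalgebra) (τ : M.toStarSubalgebra →ₗ[ℂ] ℂ),
      IsProjRep μ.1 p u ∧ IsNormalFunctional M τ ∧ IsTrace τ ∧ τ p = 1 ∧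
        {g | τ (u g) ≠ 0}.Countable := by
  obtain ⟨θ, hθ, hnorm⟩ := h
  have hrep := canonicalUnitary_isProjRep μ
  have hu : IsProjRep μ.1 (θ 1) fun g => θ (canonicalUnitary μ g) := by
    refine ⟨fun g h => ?_, fun g => ?_, fun g => ?_, fun g => ?_⟩
    · rw [← map_mul, hrep.mul, map_smul]
    · rw [← map_star, ← map_mul, hrep.star_mul_self]
    · rw [← map_star, ← map_mul, hrep.mul_star_self]
    · rw [← map_mul, one_mul]
  have hne : θ 1 ≠ 0 := fun h0 => by
    classical
    have h1 : (1 : (twistedGroupVN μ).toStarSubalgebra) = 0 := hθ (h0.trans (map_zero θ).symm)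
    have h2 : (1 : L2G G →L[ℂ] L2G G) = 0 := congrArg Subtype.val h1
    have h3 := DFunLike.congr_fun h2 (lp.single 2 (1 : G) (1 : ℂ))
    have h4 := congrArg (fun f : L2G G => f 1) h3
    simp at h4
  obtain ⟨τ₀, hn, hpos, hcomm, hτ₀⟩ := hfin _ hne
  have hp0 := hpos (θ 1)
  rw [hu.star_proj, hu.proj_mul_proj] at hp0 hτ₀
  have hτn : IsNormalFunctional M ((τ₀ (θ 1))⁻¹ • τ₀) := by
    have h1 := hn.smul_mul (τ₀ (θ 1))⁻¹ 1
    have h2 : (τ₀ (θ 1))⁻¹ • τ₀ ∘ₗ LinearMap.mulRight ℂ (1 : M.toStarSubalgebra) =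
        (τ₀ (θ 1))⁻¹ • τ₀ := by
      ext x
      simp
    rwa [h2] at h1
  refine ⟨θ 1, fun g => θ (canonicalUnitary μ g), (τ₀ (θ 1))⁻¹ • τ₀, hu, hτn,
    ⟨fun y => mul_nonneg (inv_nonneg.2 hp0) (hpos y), fun y z => ?_⟩, inv_mul_cancel₀ hτ₀, ?_⟩
  · simp only [LinearMap.smul_apply, hcomm y z]
  · obtain ⟨f, hf, hfτ⟩ := hnorm _ hτn
    have h1 := hf.countable_canonicalUnitary
    simpa only [hfτ] using h1

theorem IsProjRep.norm_star_le {μ : G → G → Circle} {p : M.toStarSubalgebra}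
    {u : G → M.toStarSubalgebra} (hu : IsProjRep μ p u) (g : G) :
    ‖((star (u g) : M.toStarSubalgebra) : K →L[ℂ] K)‖ ≤ 1 := by
  have h1 : ‖(p : K →L[ℂ] K)‖ = ‖(p : K →L[ℂ] K)‖ * ‖(p : K →L[ℂ] K)‖ := by
    rw [← CStarRing.norm_star_mul_self]
    congr 1
    exact congrArg Subtype.val ((congrArg (· * p) hu.star_proj).trans hu.proj_mul_proj).symm
  have h2 : ‖(p : K →L[ℂ] K)‖ = ‖(u g : K →L[ℂ] K)‖ * ‖(u g : K →L[ℂ] K)‖ := by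
    rw [← CStarRing.norm_star_mul_self]
    congr 1
    exact congrArg Subtype.val (hu.star_mul_self g).symm
  have h3 : ‖((star (u g) : M.toStarSubalgebra) : K →L[ℂ] K)‖ = ‖(u g : K →L[ℂ] K)‖ :=
    norm_star (u g : K →L[ℂ] K)
  rw [h3]
  have h4 : ‖(p : K →L[ℂ] K)‖ ≤ 1 := by nlinarith
  nlinarith

/-- The functionals `τ (· u g)` and `τ (· u h)` are far apart for `h⁻¹g` outside a countable set,
so separability of the predual makes `G` countable. -/
theorem countable_of_embedsVN (hsep : IsSeparableVN M) (hfin : IsFiniteVN M) {μ : Z2 G}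
    (h : EmbedsVN (twistedGroupVN μ) M) : Countable G := by
  obtain ⟨p, u, τ, hu, hn, hτ, hp, hc⟩ := h.exists_isProjRep hfin
  obtain ⟨D, hD, -, hdense⟩ := hsep
  choose d hdD hd using fun g =>
    hdense _ (hn.smul_mul 1 (u g)) (1 / 4) (by norm_num)
  rw [← Set.countable_univ_iff]
  have hcov : (Set.univ : Set G) ⊆ ⋃ e ∈ D, {g | d g = e} := fun g _ =>
    Set.mem_biUnion (hdD g) rfl
  refine (hD.biUnion fun e _ => ?_).mono hcov
  rcases Set.eq_empty_or_nonempty {g | d g = e} with h0 | ⟨h, hh⟩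
  · rw [h0]; exact Set.countable_empty
  refine Set.Countable.mono (fun g hg => ?_) (hc.image fun g => h * g)
  refine ⟨h⁻¹ * g, fun h0 => ?_, mul_inv_cancel_left h g⟩
  have h1 := hd g (star (u h))
  have h2 := hd h (star (u h))
  have hn1 := hu.norm_star_le h
  rw [Set.mem_ofPred_eq] at hg hh
  rw [hg] at h1
  rw [hh] at h2
  have h3 : τ (star (u h) * u g) = 0 := by
    have := hu.star_mul_mul h (h⁻¹ * g)
    rw [mul_inv_cancel_left] at this
    rw [this, map_smul, h0, smul_zero]
  have h4 : τ (star (u h) * u h) = 1 := by rw [hu.star_mul_self, hp]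
  simp only [one_smul, LinearMap.comp_apply, LinearMap.mulRight_apply, h3, h4] at h1 h2
  rw [zero_sub, norm_neg] at h1
  have h5 := norm_sub_norm_le 1 (e (star (u h)))
  rw [norm_one] at h5
  linarith

end Embedding

/-! ### Countability of the restricted classes -/

theorem theorem0p2 {G : Type u} [Group G] (H : Subgroup G) (hT : RelativePropertyT H)
    {K : Type*} [NormedAddCommGroup K] [InnerProductSpace ℂ K] [CompleteSpace K]
    (M : VonNeumannAlgebra K) (hsep : IsSeparableVN M) (hfin : IsFiniteVN M) :
    (H2.res H '' {c : H2 G | ∃ μ : Z2 G, (μ : H2 G) = c ∧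
      EmbedsVN (twistedGroupVN μ) M}).Countable := by
  by_cases hex : ∃ μ : Z2 G, EmbedsVN (twistedGroupVN μ) M
  swap
  · convert Set.countable_empty
    rw [Set.image_eq_empty]
    exact Set.eq_empty_of_forall_notMem fun c ⟨μ, _, h⟩ => hex ⟨μ, h⟩
  obtain ⟨μ₀, hμ₀⟩ := hex
  have : Countable G := countable_of_embedsVN hsep hfin hμ₀
  obtain ⟨F, δ, hδ, hF⟩ := res_eq_of_close M.toStarSubalgebra hT
  obtain ⟨D, hD, -, hdense⟩ := hsep
  have : Countable D := hD
  -- the data of a class: approximations of the functionals `τ (· u g)` for `g ∈ F`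
  have hdata : ∀ c ∈ H2.res H '' {c : H2 G | ∃ μ : Z2 G, (μ : H2 G) = c ∧
      EmbedsVN (twistedGroupVN μ) M}, ∃ (μ : Z2 G) (p : M.toStarSubalgebra)
      (u : G → M.toStarSubalgebra) (τ : M.toStarSubalgebra →ₗ[ℂ] ℂ) (d : F → D),
      H2.res H (μ : H2 G) = c ∧ IsProjRep μ.1 p u ∧ IsTrace τ ∧ τ p = 1 ∧
        ∀ (g : F) x, ‖τ (x * u g) - (d g).1 x‖ ≤ δ / 2 * ‖(x : K →L[ℂ] K)‖ := by
    rintro _ ⟨_, ⟨μ, rfl, hμ⟩, rfl⟩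
    obtain ⟨p, u, τ, hu, hn, hτ, hp, -⟩ := hμ.exists_isProjRep hfin
    choose d hdD hd using fun g : F =>
      hdense _ (hn.smul_mul 1 (u g)) (δ / 2) (by positivity)
    refine ⟨μ, p, u, τ, fun g => ⟨d g, hdD g⟩, rfl, hu, hτ, hp, fun g x => ?_⟩
    simpa using hd g x
  choose μ p u τ d hμ hu hτ hp hd using hdata
  suffices h : Function.Injective fun c : H2.res H '' {c : H2 G | ∃ μ : Z2 G, (μ : H2 G) = c ∧
      EmbedsVN (twistedGroupVN μ) M} => d c c.2 from Set.countable_coe_iff.1 h.countable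
  rintro ⟨c, hc⟩ ⟨c', hc'⟩ hdd
  refine Subtype.ext ?_
  simp only at hdd ⊢
  rw [← hμ c hc, ← hμ c' hc']
  refine hF (τ c hc) (hτ c hc) _ _ _ _ _ _ (hu c hc) (hu c' hc') (hp c hc) fun g hg => ?_
  have h1 := hd c hc ⟨g, hg⟩ (star (u c' hc' g))
  have h2 := hd c' hc' ⟨g, hg⟩ (star (u c' hc' g))
  have h3 := (hu c' hc').norm_star_le g
  rw [(hu c' hc').star_mul_self, hp c' hc', ← hdd] at h2
  have h4 := norm_sub_norm_le 1 (τ c hc (star (u c' hc' g) * u c hc g))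
  have h5 := norm_sub_le_norm_sub_add_norm_sub 1 ((d c hc ⟨g, hg⟩).1 (star (u c' hc' g)))
    (τ c hc (star (u c' hc' g) * u c hc g))
  rw [norm_sub_rev] at h1
  rw [norm_one] at h4
  have h6 : δ / 2 * ‖((star (u c' hc' g) : M.toStarSubalgebra) : K →L[ℂ] K)‖ ≤ δ / 2 :=
    mul_le_of_le_one_right (by positivity) h3
  linarith
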